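/- Consider $\min_{x\in\mathbb R^n} H(x):=F(x)+R(x)$ with $F=f\circ g$, $f(y)=\mathbb E_v[f_v(y)]$, $g(x)=\mathbb E_w[g_w(x)]$, where $(w,v)$ is a random pair (not necessarily independent components), $g_w:\mathbb R^n\to\mathbb R^m$ and $f_v:\mathbb R^m\to\mathbb R$ are continuously differentiable, and $R:\mathbb R^n\to\mathbb R\cup\{+\infty\}$ is proper, closed and convex. Suppose that $F$ is convex and that the set $X^*$ of minimizers of $H$ is nonempty, and write $\mathcal P_{X^*}$ for the Euclidean projection onto $X^*$. Assume that $H$ is optimally strongly convex with parameter $\lambda>0$: $$H(x)-H(\mathcal P_{X^*}x)\ \ge\ \lambda\|x-\mathcal P_{X^*}x\|^2\qquad\text{for all }x,$$ and that there are constants $\sigma, C, L_F, L_f, L_g\ge 0$ such that, with probability one where $w,v$ occur, 1. $\mathbb E[\nabla g_w(x)^\top\nabla f_v(y)]=\nabla g(x)^\top\nabla f(y)$ and $\mathbb E[g_w(x)]=g(x)$ for all $x,y$; 2. $\mathbb E\|g_w(x)-g(x)\|^2\le\sigma^2$ for all $x$; 3. $\|\nabla f_v(y)\|\le C$ and $\|\nabla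 g_w(x)\|\le C$ for all $x,y$, and at every point $x$ with $R(x)<+\infty$ the function $R$ has a subgradient of norm at most $C$; 4. $F(z)-F(x)\le\langle\nabla F(x),z-x\rangle+\frac{L_F}{2}\|z-x\|^2$ for all $x,z$; $\|\nabla f_v(y)-\nabla f_v(u)\|\le L_f\|y-u\|$ for all $y,u$; and $\|g(x)-g(z)-\nabla g(z)(x-z)\|\le\frac{L_g}{2}\|x-z\|^2$ for all $x,z$ (with $\nabla g(z)$ the Jacobian acting on $x-z$). Let $(w_k,v_k)_{k\ge1}$ be independent copies of $(w,v)$, and let $\alpha_k=C_ak^{-a}$, $\beta_k=C_bk^{-b}$ with $a,b\in(0,1]$, $C_b>2$, $C_a>0$, and, in case $a=1$, $C_a>\frac1{2\lambda}$. Given $x_1,z_1\in\mathbb R^n$, $y_0\in\mathbb R^m$, $\beta_0\in\mathbb R$, put $y_1=(1-\beta_0)y_0+\beta_0g_{w_1}(z_1)$ and, for $k\ge1$ (the ASC-PG algorithm), $$x_{k+1}=\operatorname{prox}_{\alpha_kR}\bigl(x_k-\alpha_k\nabla g_{w_k}(x_k)^\top\nabla f_{v_k}(y_k)\bigr),\quad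 z_{k+1}=\Bigl(1-\frac1{\beta_k}\Bigr)x_k+\frac1{\beta_k}x_{k+1},\quad y_{k+1}=(1-\beta_k)y_k+\beta_kg_{w_{k+1}}(z_{k+1}),$$ where $\operatorname{prox}_{\alpha R}(u)=\arg\min_q\{\frac12\|q-u\|^2+\alpha R(q)\}$. Then there is a constant $c>0$, not depending on $k$, such that for all $k\ge1$ $$\mathbb E\|x_k-\mathcal P_{X^*}(x_k)\|^2\ \le\ c\left(k^{-a}+L_f^2L_g\,k^{-4a+4b}+L_f^2\,k^{-b}\right).$$ In particular the left-hand side is $O(k^{-4/5})$ if $a=1$, $b=4/5$, and it is $O(k^{-1})$ if $a=b=1$ and ($L_f=0$ or $L_g=0$). -/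

import Mathlib

open MeasureTheory ProbabilityTheory

/-- The Euclidean space `ℝⁿ`. -/
abbrev RSpace (n : ℕ) : Type := EuclideanSpace ℝ (Fin n)

noncomputable section

/-! ### Convex analysis for functions with values in `ℝ ∪ {+∞}` -/

/-- A closed (lower semicontinuous) convex function `R : ℝⁿ → ℝ ∪ {+∞}`, not identically `+∞`.
Convexity is convexity of the epigraph. -/
structure ClosedConvexFun {n : ℕ} (R : RSpace n → EReal) : Prop where
  ne_bot : ∀ x, R x ≠ ⊥
  proper : ∃ x, R x ≠ ⊤
  lsc : LowerSemicontinuous R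
  convex_epigraph : Convex ℝ {p : RSpace n × ℝ | R p.1 ≤ (p.2 : EReal)}

/-- `s ∈ ∂R(x)`, for `x` in the effective domain of `R`. -/
def IsSubgradient {n : ℕ} (R : RSpace n → EReal) (x s : RSpace n) : Prop :=
  R x ≠ ⊤ ∧ ∀ z, R x + ((inner ℝ s (z - x) : ℝ) : EReal) ≤ R z

/-- `p = prox_{α R}(u)`: the point `p` minimizes `½‖q - u‖² + α R(q)` over `q`. (For `α > 0` and
`R` closed convex there is exactly one such `p`.) -/
def IsProx {n : ℕ} (α : ℝ) (R : RSpace n → EReal) (u p : RSpace n) : Prop :=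
  ∀ q, ((1 / 2 * ‖p - u‖ ^ 2 : ℝ) : EReal) + (α : EReal) * R p
    ≤ ((1 / 2 * ‖q - u‖ ^ 2 : ℝ) : EReal) + (α : EReal) * R q

/-- The Euclidean projection of `x` onto `S`: a nearest point of `S`
(it exists and is unique when `S` is nonempty, closed and convex). -/
def euclProj {n : ℕ} (S : Set (RSpace n)) (x : RSpace n) : RSpace n :=
  Classical.epsilon fun p => p ∈ S ∧ ∀ q ∈ S, ‖x - p‖ ≤ ‖x - q‖

/-! ### The stochastic composition problem -/

section Problem

variable {W V : Type*} [MeasurableSpace W] [MeasurableSpace V] {n m : ℕ}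

/-- The data of the problem: `P` is the joint law of the (possibly dependent) pair `(w, v)`,
`f_v` and `g_w` are the continuously differentiable random functions, with well-defined
expectations, and `R` is the closed convex penalty. -/
structure ProblemData (P : Measure (W × V)) (f : V → RSpace m → ℝ)
    (g : W → RSpace n → RSpace m) (R : RSpace n → EReal) : Prop where
  f_contDiff : ∀ v, ContDiff ℝ 1 (f v)
  g_contDiff : ∀ w, ContDiff ℝ 1 (g w)
  f_meas : ∀ y, Measurable fun v => f v y
  g_meas : ∀ x, Measurable fun w => g w x
  f_int : ∀ y, Integrable (fun p : W × V => f p.2 y) P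
  g_int : ∀ x, Integrable (fun p : W × V => g p.1 x) P
  R_closedConvex : ClosedConvexFun R

/-- `f(y) = 𝔼_v f_v(y)`. -/
def meanOuter (P : Measure (W × V)) (f : V → RSpace m → ℝ) (y : RSpace m) : ℝ :=
  ∫ p, f p.2 y ∂P

/-- `g(x) = 𝔼_w g_w(x)`. -/
def meanInner (P : Measure (W × V)) (g : W → RSpace n → RSpace m) (x : RSpace n) : RSpace m :=
  ∫ p, g p.1 x ∂P

/-- `F(x) = f(g(x)) = 𝔼_v f_v(𝔼_w g_w(x))`. -/
def smoothPart (P : Measure (W × V)) (f : V → RSpace m → ℝ) (g : W → RSpace n → RSpace m)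
    (x : RSpace n) : ℝ :=
  meanOuter P f (meanInner P g x)

/-- The objective `H = F + R`. -/
def objective (P : Measure (W × V)) (f : V → RSpace m → ℝ) (g : W → RSpace n → RSpace m)
    (R : RSpace n → EReal) (x : RSpace n) : EReal :=
  (smoothPart P f g x : EReal) + R x

/-- The set `X*` of minimizers of `H`. -/
def optimalSet (H : RSpace n → EReal) : Set (RSpace n) :=
  {x | ∀ z, H x ≤ H z}

/-- Optimal strong convexity with parameter `lam`:
`H(x) - H(P_{X*} x) ≥ lam ‖x - P_{X*} x‖²` for all `x`. -/
def OptimallyStronglyConvex (H : RSpace n → EReal) (lam : ℝ) : Prop :=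
  ∀ x, H (euclProj (optimalSet H) x)
    + ((lam * ‖x - euclProj (optimalSet H) x‖ ^ 2 : ℝ) : EReal) ≤ H x

/-- `∇γ(x)ᵀ ∇φ(y)`, where `∇γ(x)` is the Jacobian of `γ` at `x`. -/
def compGrad (γ : RSpace n → RSpace m) (φ : RSpace m → ℝ) (x : RSpace n) (y : RSpace m) :
    RSpace n :=
  (ContinuousLinearMap.adjoint (fderiv ℝ γ x)) (gradient φ y)

/-! ### Assumptions on the sampling oracle -/

/-- Unbiasedness: the gradient samples satisfy
`𝔼[∇g_w(x)ᵀ ∇f_v(y)] = ∇g(x)ᵀ ∇f(y)` for all `x`, `y`, and `𝔼[g_w(x)] = g(x)` for all `x`. -/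
structure UnbiasedOracle (P : Measure (W × V)) (f : V → RSpace m → ℝ)
    (g : W → RSpace n → RSpace m) : Prop where
  grad : ∀ x y, ∫ p, compGrad (g p.1) (f p.2) x y ∂P
    = compGrad (meanInner P g) (meanOuter P f) x y
  value : ∀ x, ∫ p, g p.1 x ∂P = meanInner P g x

/-- Bounded variance: `𝔼‖g_w(x) - g(x)‖² ≤ σ²` for all `x`. -/
def BoundedVariance (P : Measure (W × V)) (g : W → RSpace n → RSpace m) (σ : ℝ) : Prop :=
  ∀ x, Integrable (fun p : W × V => ‖g p.1 x - meanInner P g x‖ ^ 2) P ∧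
    ∫ p, ‖g p.1 x - meanInner P g x‖ ^ 2 ∂P ≤ σ ^ 2

/-- With probability one, `∇f_v` and `∇g_w` are bounded by `C` everywhere, and `R` has a
subgradient bounded by `C` at every point of its effective domain. -/
structure BoundedGradients (P : Measure (W × V)) (f : V → RSpace m → ℝ)
    (g : W → RSpace n → RSpace m) (R : RSpace n → EReal) (C : ℝ) : Prop where
  outer : ∀ᵐ p ∂P, ∀ y, ‖gradient (f p.2) y‖ ≤ C
  inner : ∀ᵐ p ∂P, ∀ x, ‖fderiv ℝ (g p.1) x‖ ≤ C
  penalty : ∀ x, R x ≠ ⊤ → ∃ s, IsSubgradient R x s ∧ ‖s‖ ≤ C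

/-- The Lipschitz-type smoothness conditions with constants `LF`, `Lf`, `Lg`. -/
structure SmoothnessConditions (P : Measure (W × V)) (f : V → RSpace m → ℝ)
    (g : W → RSpace n → RSpace m) (LF Lf Lg : ℝ) : Prop where
  nonneg_F : 0 ≤ LF
  nonneg_f : 0 ≤ Lf
  nonneg_g : 0 ≤ Lg
  composition : ∀ x z, smoothPart P f g z - smoothPart P f g x
    ≤ inner ℝ (gradient (smoothPart P f g) x) (z - x) + LF / 2 * ‖z - x‖ ^ 2
  outer : ∀ᵐ p ∂P, ∀ y u, ‖gradient (f p.2) y - gradient (f p.2) u‖ ≤ Lf * ‖y - u‖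
  inner : ∀ x z, ‖meanInner P g x - meanInner P g z - fderiv ℝ (meanInner P g) z (x - z)‖
    ≤ Lg / 2 * ‖x - z‖ ^ 2

/-! ### The algorithm -/

/-- The oracle queries `ζ k = (w_k, v_k)`, `k ≥ 1`: independent, each with law `P`. -/
structure OracleSamples {Ω : Type*} [MeasurableSpace Ω] (μ : Measure Ω) (P : Measure (W × V))
    (ζ : ℕ → Ω → W × V) : Prop where
  meas : ∀ k, Measurable (ζ k)
  law : ∀ k, 1 ≤ k → μ.map (ζ k) = P
  indep : iIndepFun ζ μ

/-- `(x_k)`, `(y_k)`, `(z_k)`, `k ≥ 1`, are the iterates of the accelerated stochastic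
compositional proximal gradient method with step sizes `α_k`, `β_k` (`k ≥ 1`), along the samples
`ζ k = (w_k, v_k)`. The start is given by `x₁`, `z₁`, `y₀` and an arbitrary weight `β₀`, with
`y_1 = (1 - β₀) y₀ + β₀ g_{w_1}(z₁)`; for `β₀ = 0` this is an arbitrary fixed vector. The entries
of index `0` of the sequences play no role. -/
structure IsASCPG {Ω : Type*} (f : V → RSpace m → ℝ) (g : W → RSpace n → RSpace m)
    (R : RSpace n → EReal) (α β : ℕ → ℝ) (ζ : ℕ → Ω → W × V)
    (x₁ z₁ : RSpace n) (y₀ : RSpace m) (β₀ : ℝ)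
    (x z : ℕ → Ω → RSpace n) (y : ℕ → Ω → RSpace m) : Prop where
  x_init : ∀ ω, x 1 ω = x₁
  z_init : ∀ ω, z 1 ω = z₁
  y_init : ∀ ω, y 1 ω = (1 - β₀) • y₀ + β₀ • g (ζ 1 ω).1 (z 1 ω)
  x_step : ∀ k, 1 ≤ k → ∀ ω, IsProx (α k) R
    (x k ω - α k • compGrad (g (ζ k ω).1) (f (ζ k ω).2) (x k ω) (y k ω)) (x (k + 1) ω)
  z_step : ∀ k, 1 ≤ k → ∀ ω,
    z (k + 1) ω = (1 - 1 / β k) • x k ω + (1 / β k) • x (k + 1) ω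
  y_step : ∀ k, 1 ≤ k → ∀ ω,
    y (k + 1) ω = (1 - β k) • y k ω + β k • g (ζ (k + 1) ω).1 (z (k + 1) ω)

end Problem

/-- `𝔼‖x_k - P_S(x_k)‖² = O(r_k)`: there is a constant `c > 0` such that for every `k ≥ 1` the
expectation exists and is at most `c r_k`. -/
def MeanSqDistBigO {Ω : Type*} [MeasurableSpace Ω] (μ : Measure Ω) {n : ℕ}
    (x : ℕ → Ω → RSpace n) (S : Set (RSpace n)) (r : ℕ → ℝ) : Prop :=
  ∃ c : ℝ, 0 < c ∧ ∀ k : ℕ, 1 ≤ k →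
    Integrable (fun ω => ‖x k ω - euclProj S (x k ω)‖ ^ 2) μ ∧
    ∫ ω, ‖x k ω - euclProj S (x k ω)‖ ^ 2 ∂μ ≤ c * r k

end

/-! ### Subgradients, proximal points and first-order convexity. -/

section ConvexAnalysis

variable {n : ℕ} {R : RSpace n → EReal}

/-! Two mean square errors are followed: the tracking error e_k = 𝔼‖y_k - g(x_k)‖² and the distance
d_k = 𝔼‖x_k - P(x_k)‖², P being the projection onto X*.

Tracking (`tracking_recursion`). The extrapolated point z_{k+1} is chosen so that x_{k+1} = (1-β_k)
x_k + β_k z_{k+1}. Hence the linear terms cancel when y is compared with g along the path, and the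
drift is only quadratic, O(L_g α_k²/β_k). The sampling noise has mean zero given the past, so it
adds just β_k² σ². Thus e_{k+1} ≤ (1-β_k) e_k + O(L_g² α_k⁴/β_k³) + β_k² σ². Dividing the source by
β_k gives the order L_g k^{-4a+4b} + k^{-b}, for fixed L_g.

Distance (`distance_recursion`). The variational inequality of the proximal step, convexity of F and
optimal strong convexity at x_k give a contraction by 1 - 2λα_k, up to O(α_k²) and the gradient
error (`sq_dist_prox_step_le`). Replacing y_k by g(x_k) in the sampled gradient makes its error
conditionally centred; the replacement costs C L_f ‖y_k - g(x_k)‖. Young's inequality then yields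
d_{k+1} ≤ (1-(2λ-δ)α_k) d_k + O(L_f² α_k) e_k + O(α_k²).

Both recursions are solved by the Chung-type lemma `exists_rate_bound`: the solution has the order
of source over contraction rate, provided that this order does not decay faster than the contraction
allows. For exponent 1 this is where the lower bounds on C_a and C_b enter. -/

lemma ClosedConvexFun.exists_coe (hR : ClosedConvexFun R) {x : RSpace n} (hx : R x ≠ ⊤) :
    ∃ r : ℝ, R x = r :=
  ⟨(R x).toReal, (EReal.coe_toReal hx (hR.ne_bot x)).symm⟩

lemma ClosedConvexFun.le_combo (hR : ClosedConvexFun R) {x y : RSpace n} {rx ry s t : ℝ}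
    (hx : R x = rx) (hy : R y = ry) (hs : 0 ≤ s) (ht : 0 ≤ t) (hst : s + t = 1) :
    R (s • x + t • y) ≤ ((s * rx + t * ry : ℝ) : EReal) := by
  have h := hR.convex_epigraph (x := (x, rx)) (by simp [hx]) (y := (y, ry)) (by simp [hy]) hs ht hst
  simpa using h

lemma IsSubgradient.real_le {x s z : RSpace n} {rx rz : ℝ} (h : IsSubgradient R x s)
    (hx : R x = rx) (hz : R z = rz) : rx + inner ℝ s (z - x) ≤ rz := by
  have := h.2 z
  rw [hx, hz] at this
  exact_mod_cast this

lemma IsProx.ne_top {α : ℝ} {u p : RSpace n} (h : IsProx α R u p) (hR : ClosedConvexFun R)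
    (hα : 0 < α) : R p ≠ ⊤ := by
  intro hp
  obtain ⟨q, hq⟩ := hR.proper
  obtain ⟨r, hr⟩ := hR.exists_coe hq
  have h1 := h q
  rw [hp, hr, EReal.coe_mul_top_of_pos hα, EReal.coe_add_top] at h1
  rw [← EReal.coe_mul, ← EReal.coe_add, top_le_iff] at h1
  exact EReal.coe_ne_top _ h1

lemma IsProx.real_le {α : ℝ} {u p q : RSpace n} {rp rq : ℝ} (h : IsProx α R u p) (hα : 0 < α)
    (hp : R p = rp) (hq : R q ≤ (rq : EReal)) :
    1 / 2 * ‖p - u‖ ^ 2 + α * rp ≤ 1 / 2 * ‖q - u‖ ^ 2 + α * rq := by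
  have h1 := h q
  rw [hp] at h1
  have h2 : (α : EReal) * R q ≤ (α : EReal) * (rq : EReal) :=
    mul_le_mul_of_nonneg_left hq (by exact_mod_cast hα.le)
  have h3 := h1.trans (add_le_add_right h2 _)
  exact_mod_cast h3

lemma nonneg_of_forall_mul_add_sq {B D : ℝ} (hD : 0 ≤ D)
    (h : ∀ t : ℝ, 0 < t → t ≤ 1 → 0 ≤ t * B + t ^ 2 * D) : 0 ≤ B := by
  by_contra! hB
  have hpos : 0 < D - B := by linarith
  -- This t lies in (0, 1] also when D = 0, and turns the quadratic into B³/(D-B)² < 0.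
  have h1 := h (-B / (D - B)) (div_pos (by linarith) hpos) ((div_le_one hpos).2 (by linarith))
  have h2 : -B / (D - B) * B + (-B / (D - B)) ^ 2 * D = B ^ 3 / (D - B) ^ 2 := by
    field_simp
    ring
  rw [h2] at h1
  have : B ^ 3 / (D - B) ^ 2 < 0 := div_neg_of_neg_of_pos (by nlinarith [sq_nonneg B, mul_pos_of_neg_of_neg hB hB]) (by positivity)
  linarith

/-- The first-order condition: compare p with (1-t)p + tq, use convexity of R, divide by t and let t
tend to 0. -/
lemma IsProx.inner_le {α : ℝ} {u p q : RSpace n} {rp rq : ℝ} (h : IsProx α R u p)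
    (hR : ClosedConvexFun R) (hα : 0 < α) (hp : R p = rp) (hq : R q = rq) :
    inner ℝ (u - p) (q - p) ≤ α * (rq - rp) := by
  have key : 0 ≤ α * (rq - rp) - inner ℝ (u - p) (q - p) := by
    refine nonneg_of_forall_mul_add_sq (D := 1 / 2 * ‖q - p‖ ^ 2) (by positivity) fun t ht0 ht1 => ?_
    have h1 := hR.le_combo hp hq (s := 1 - t) (t := t) (by linarith) ht0.le (by ring)
    have h2 := h.real_le hα hp h1
    have h3 : (1 - t) • p + t • q - u = t • (q - p) - (u - p) := by module
    have h4 : ‖p - u‖ = ‖u - p‖ := norm_sub_rev _ _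
    rw [h3, h4, norm_sub_sq_real (t • (q - p)), norm_smul, inner_smul_left, real_inner_comm, mul_pow,
      Real.norm_eq_abs, sq_abs] at h2
    simp only [conj_trivial] at h2
    nlinarith
  linarith

/-- The proximal map is nonexpansive. -/
lemma IsProx.norm_sub_le {α : ℝ} {u p u' p' : RSpace n} (h : IsProx α R u p)
    (h' : IsProx α R u' p') (hR : ClosedConvexFun R) (hα : 0 < α) : ‖p - p'‖ ≤ ‖u - u'‖ := by
  obtain ⟨r, hr⟩ := hR.exists_coe (h.ne_top hR hα)
  obtain ⟨r', hr'⟩ := hR.exists_coe (h'.ne_top hR hα)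
  have h1 := h.inner_le hR hα hr hr'
  have h2 := h'.inner_le hR hα hr' hr
  have h3 : ‖p - p'‖ ^ 2 ≤ inner ℝ (u - u') (p - p') := by
    have e : inner ℝ (u - p) (p' - p) + inner ℝ (u' - p') (p - p')
        = ‖p - p'‖ ^ 2 - inner ℝ (u - u') (p - p') := by
      rw [← neg_sub p p', inner_neg_right, ← real_inner_self_eq_norm_sq, ← sub_eq_zero]
      simp only [inner_sub_left]
      ring
    nlinarith
  have h4 := real_inner_le_norm (u - u') (p - p')
  rcases (norm_nonneg (p - p')).eq_or_lt with h0 | h0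
  · rw [← h0]; positivity
  · nlinarith

/-- A point `q` with `s ∈ ∂R(q)` is the proximal point of `q + α s`. -/
lemma IsProx.norm_sub_le_of_isSubgradient {α : ℝ} {u p q s : RSpace n} (h : IsProx α R u p)
    (hs : IsSubgradient R q s) (hR : ClosedConvexFun R) (hα : 0 < α) :
    ‖p - q‖ ≤ ‖u - q - α • s‖ := by
  obtain ⟨r, hr⟩ := hR.exists_coe (h.ne_top hR hα)
  obtain ⟨r', hr'⟩ := hR.exists_coe hs.1
  have h1 := h.inner_le hR hα hr hr'
  have h2 := hs.real_le hr' hr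
  have h3 : ‖p - q‖ ^ 2 ≤ inner ℝ (u - q - α • s) (p - q) := by
    have e : inner ℝ (u - q - α • s) (p - q)
        = ‖p - q‖ ^ 2 - inner ℝ (u - p) (q - p) - α * inner ℝ s (p - q) := by
      rw [← neg_sub p q, inner_neg_right, ← real_inner_self_eq_norm_sq, ← sub_eq_zero]
      simp only [inner_sub_left, inner_smul_left, conj_trivial]
      ring
    nlinarith
  have h4 := real_inner_le_norm (u - q - α • s) (p - q)
  rcases (norm_nonneg (p - q)).eq_or_lt with h0 | h0
  · rw [← h0]; positivity
  · nlinarith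

/-- The proximal map extends to a continuous function on the whole space. -/
lemma exists_continuous_prox (hR : ClosedConvexFun R) {α : ℝ} (hα : 0 < α) :
    ∃ T : RSpace n → RSpace n, Continuous T ∧ ∀ u p, IsProx α R u p → p = T u := by
  classical
  let T₀ : RSpace n → RSpace n := fun u => if h : ∃ p, IsProx α R u p then h.choose else 0
  have hT₀ : ∀ u p, IsProx α R u p → IsProx α R u (T₀ u) := fun u p hp => by
    have h : ∃ p, IsProx α R u p := ⟨p, hp⟩
    simp only [T₀, dif_pos h]
    exact h.choose_spec
  have hlip : LipschitzOnWith 1 T₀ {u | ∃ p, IsProx α R u p} := by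
    refine LipschitzOnWith.of_dist_le_mul ?_
    rintro u ⟨p, hp⟩ u' ⟨p', hp'⟩
    rw [NNReal.coe_one, one_mul, dist_eq_norm, dist_eq_norm]
    exact (hT₀ u p hp).norm_sub_le (hT₀ u' p' hp') hR hα
  -- Existence of proximal points is not needed: T₀ is 1-Lipschitz where they exist, and any
  -- Lipschitz extension, even with a larger constant, is continuous.
  obtain ⟨T, hT, hTeq⟩ := hlip.extend_finite_dimension
  refine ⟨T, hT.continuous, fun u p hp => ?_⟩
  rw [← hTeq ⟨p, hp⟩]
  have := hp.norm_sub_le (hT₀ u p hp) hR hα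
  rw [sub_self, norm_zero] at this
  exact sub_eq_zero.1 (norm_le_zero_iff.1 this)

lemma ConvexOn.inner_gradient_le {F : RSpace n → ℝ} (hF : ConvexOn ℝ Set.univ F) {x : RSpace n}
    (hx : DifferentiableAt ℝ F x) (z : RSpace n) :
    F x + inner ℝ (gradient F x) (z - x) ≤ F z := by
  let ℓ : ℝ → RSpace n := fun t => x + t • (z - x)
  have hℓ : HasDerivAt ℓ (z - x) 0 := by
    have h := ((hasDerivAt_id (0 : ℝ)).smul_const (z - x)).const_add x
    rwa [one_smul] at h
  have hc : ConvexOn ℝ Set.univ (F ∘ ℓ) := by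
    have h := hF.comp_affineMap (AffineMap.lineMap x z)
    have e : ⇑(AffineMap.lineMap (k := ℝ) x z) = ℓ := by
      funext t
      rw [AffineMap.lineMap_apply, vsub_eq_sub, vadd_eq_add, add_comm]
    rwa [Set.preimage_univ, e] at h
  have hd : HasDerivAt (F ∘ ℓ) (inner ℝ (gradient F x) (z - x)) 0 := by
    have h0 : ℓ 0 = x := by simp [ℓ]
    have h1 : HasFDerivAt F (InnerProductSpace.toDual ℝ _ (gradient F x)) (ℓ 0) := by
      rw [h0]; exact hx.hasGradientAt
    simpa using h1.comp_hasDerivAt (0 : ℝ) hℓ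
  have h := hc.le_slope_of_hasDerivAt (Set.mem_univ 0) (Set.mem_univ 1) one_pos hd
  rw [slope_def_field] at h
  simp only [Function.comp_apply, ℓ, one_smul, zero_smul, add_zero, sub_zero, div_one,
    add_sub_cancel] at h
  linarith

end ConvexAnalysis

/-! ### Projection onto a closed convex set. -/

section Projection

variable {n : ℕ} {S : Set (RSpace n)}

lemma euclProj_spec (hne : S.Nonempty) (hcl : IsClosed S) (hcv : Convex ℝ S) (x : RSpace n) :
    euclProj S x ∈ S ∧ ∀ q ∈ S, ‖x - euclProj S x‖ ≤ ‖x - q‖ := by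
  refine Classical.epsilon_spec (p := fun p => p ∈ S ∧ ∀ q ∈ S, ‖x - p‖ ≤ ‖x - q‖) ?_
  obtain ⟨p, hp, h⟩ := exists_norm_eq_iInf_of_complete_convex hne hcl.isComplete hcv x
  refine ⟨p, hp, fun q hq => ?_⟩
  rw [h]
  exact ciInf_le (f := fun w : S => ‖x - w‖) ⟨0, by rintro _ ⟨w, rfl⟩; positivity⟩ ⟨q, hq⟩

lemma inner_sub_euclProj_le (hne : S.Nonempty) (hcl : IsClosed S) (hcv : Convex ℝ S)
    (x : RSpace n) {q : RSpace n} (hq : q ∈ S) :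
    inner ℝ (x - euclProj S x) (q - euclProj S x) ≤ 0 := by
  obtain ⟨h1, h2⟩ := euclProj_spec hne hcl hcv x
  refine (norm_eq_iInf_iff_real_inner_le_zero hcv h1).1 ?_ q hq
  have : Nonempty S := hne.to_subtype
  refine le_antisymm (le_ciInf fun w => h2 w w.2) ?_
  exact ciInf_le (f := fun w : S => ‖x - w‖) ⟨0, by rintro _ ⟨w, rfl⟩; positivity⟩ ⟨_, h1⟩

lemma continuous_euclProj (hne : S.Nonempty) (hcl : IsClosed S) (hcv : Convex ℝ S) :
    Continuous (euclProj S) := by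
  refine (LipschitzWith.of_dist_le_mul (K := 1) fun x y => ?_).continuous
  rw [NNReal.coe_one, one_mul, dist_eq_norm, dist_eq_norm]
  have h1 := inner_sub_euclProj_le hne hcl hcv x (euclProj_spec hne hcl hcv y).1
  have h2 := inner_sub_euclProj_le hne hcl hcv y (euclProj_spec hne hcl hcv x).1
  set p := euclProj S x
  set p' := euclProj S y
  have h3 : ‖p - p'‖ ^ 2 ≤ inner ℝ (x - y) (p - p') := by
    have e : inner ℝ (x - p) (p' - p) + inner ℝ (y - p') (p - p')
        = ‖p - p'‖ ^ 2 - inner ℝ (x - y) (p - p') := by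
      rw [← neg_sub p p', inner_neg_right, ← real_inner_self_eq_norm_sq, ← sub_eq_zero]
      simp only [inner_sub_left]
      ring
    nlinarith
  have h4 := real_inner_le_norm (x - y) (p - p')
  rcases (norm_nonneg (p - p')).eq_or_lt with h0 | h0
  · rw [← h0]; positivity
  · nlinarith

end Projection

/-! ### The set of minimizers and one proximal gradient step. -/

section Objective

variable {n : ℕ} {R : RSpace n → EReal} {F : RSpace n → ℝ}

lemma ne_top_of_mem_optimalSet (hR : ClosedConvexFun R) {x : RSpace n}
    (hx : x ∈ optimalSet fun z => (F z : EReal) + R z) : R x ≠ ⊤ := by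
  intro h
  obtain ⟨q, hq⟩ := hR.proper
  obtain ⟨r, hr⟩ := hR.exists_coe hq
  have := hx q
  simp only [h, hr, EReal.coe_add_top, ← EReal.coe_add, top_le_iff] at this
  exact EReal.coe_ne_top _ this

lemma convex_optimalSet (hR : ClosedConvexFun R) (hF : ConvexOn ℝ Set.univ F) :
    Convex ℝ (optimalSet fun z => (F z : EReal) + R z) := by
  intro x hx y hy s t hs ht hst w
  obtain ⟨rx, hrx⟩ := hR.exists_coe (ne_top_of_mem_optimalSet hR hx)
  obtain ⟨ry, hry⟩ := hR.exists_coe (ne_top_of_mem_optimalSet hR hy)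
  have h1 := hR.le_combo hrx hry hs ht hst
  have h2 := hF.2 (Set.mem_univ x) (Set.mem_univ y) hs ht hst
  have h3 := hy x
  simp only [hrx, hry, ← EReal.coe_add, EReal.coe_le_coe_iff, smul_eq_mul] at h2 h3
  refine le_trans ?_ (hx w)
  simp only [hrx]
  refine (add_le_add (EReal.coe_le_coe_iff.2 h2) h1).trans ?_
  rw [← EReal.coe_add, ← EReal.coe_add, EReal.coe_le_coe_iff]
  have h4 : t * (F y + ry) ≤ t * (F x + rx) := mul_le_mul_of_nonneg_left h3 ht
  have h5 : s * (F x + rx) + t * (F x + rx) = F x + rx := by rw [← add_mul, hst, one_mul]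
  linarith

lemma isClosed_optimalSet (hR : ClosedConvexFun R) (hF : Continuous F) :
    IsClosed (optimalSet fun z => (F z : EReal) + R z) := by
  rcases (optimalSet fun z => (F z : EReal) + R z).eq_empty_or_nonempty with h | ⟨x, hx⟩
  · rw [h]; exact isClosed_empty
  obtain ⟨rx, hrx⟩ := hR.exists_coe (ne_top_of_mem_optimalSet hR hx)
  have he : (optimalSet fun z => (F z : EReal) + R z)
      = {y | R y ≤ ((F x + rx - F y : ℝ) : EReal)} := by
    ext y
    have key : (F y : EReal) + R y ≤ (F x : EReal) + R x
        ↔ R y ≤ ((F x + rx - F y : ℝ) : EReal) := by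
      rw [hrx]
      by_cases hy : R y = ⊤
      · simp only [hy, EReal.coe_add_top, ← EReal.coe_add, top_le_iff, EReal.coe_ne_top]
      · obtain ⟨ry, hry⟩ := hR.exists_coe hy
        rw [hry, ← EReal.coe_add, ← EReal.coe_add, EReal.coe_le_coe_iff, EReal.coe_le_coe_iff]
        constructor <;> intro h <;> linarith
    rw [Set.mem_ofPred_eq, ← key]
    exact ⟨fun h => h x, fun h z => h.trans (hx z)⟩
  rw [he]
  -- R takes the value +∞, so H is not handled directly: the set is the preimage of the closed
  -- epigraph of R under y ↦ (y, min H - F(y)).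
  exact hR.lsc.isClosed_epigraph.preimage (f := fun y => (y, ((F x + rx - F y : ℝ) : EReal)))
    (continuous_id.prodMk (continuous_coe_real_ereal.comp (continuous_const.sub hF)))

/-- One proximal gradient step with an inexact gradient `G` under optimal strong convexity. -/
lemma sq_dist_prox_step_le (hR : ClosedConvexFun R) (hF : ConvexOn ℝ Set.univ F)
    (hFd : Differentiable ℝ F) {lam : ℝ}
    (hne : (optimalSet fun z => (F z : EReal) + R z).Nonempty)
    (hosc : OptimallyStronglyConvex (fun z => (F z : EReal) + R z) lam)
    {C K α : ℝ} (hα : 0 < α) {x x' G s : RSpace n} (hs : IsSubgradient R x s) (hsC : ‖s‖ ≤ C)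
    (hG : ‖G‖ ≤ K) (hx' : IsProx α R (x - α • G) x') :
    ‖x' - euclProj (optimalSet fun z => (F z : EReal) + R z) x'‖ ^ 2
      ≤ (1 - 2 * lam * α) * ‖x - euclProj (optimalSet fun z => (F z : EReal) + R z) x‖ ^ 2
        - 2 * α * inner ℝ (G - gradient F x)
            (x - euclProj (optimalSet fun z => (F z : EReal) + R z) x)
        + 2 * (K + C) ^ 2 * α ^ 2 := by
  have hoscx := hosc x
  have hcl := isClosed_optimalSet hR hFd.continuous
  have hcv := convex_optimalSet hR hF
  have hmem := (euclProj_spec hne hcl hcv x).1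
  have hproj := (euclProj_spec hne hcl hcv x').2 _ hmem
  set p := euclProj (optimalSet fun z => (F z : EReal) + R z) x
  set p' := euclProj (optimalSet fun z => (F z : EReal) + R z) x'
  obtain ⟨rx, hrx⟩ := hR.exists_coe hs.1
  obtain ⟨rp, hrp⟩ := hR.exists_coe (ne_top_of_mem_optimalSet hR hmem)
  obtain ⟨r', hr'⟩ := hR.exists_coe (hx'.ne_top hR hα)
  have h1 := hx'.inner_le hR hα hr' hrp
  have h2 := hs.real_le hrx hr'
  have h3 := hF.inner_gradient_le (hFd x) p
  simp only [hrx, hrp, ← EReal.coe_add, EReal.coe_le_coe_iff] at hoscx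
  have hstep : ‖x' - x‖ ≤ (K + C) * α := by
    have := hx'.norm_sub_le_of_isSubgradient hs hR hα
    have e : x - α • G - x - α • s = -(α • (G + s)) := by module
    rw [e, norm_neg, norm_smul, Real.norm_eq_abs, abs_of_pos hα] at this
    nlinarith [norm_add_le G s]
  have h4 := real_inner_le_norm (-(G + s)) (x' - x)
  have h5 : ‖-(G + s)‖ ≤ K + C := by rw [norm_neg]; linarith [norm_add_le G s]
  have h6 : inner ℝ (-(G + s)) (x' - x) ≤ (K + C) * ((K + C) * α) :=
    h4.trans (mul_le_mul h5 hstep (norm_nonneg _) ((norm_nonneg _).trans h5))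
  have h7 : ‖x' - p'‖ ^ 2 ≤ ‖x' - p‖ ^ 2 := pow_le_pow_left₀ (norm_nonneg _) hproj 2
  have e1 : ‖x' - p‖ ^ 2 = ‖x' - x‖ ^ 2 + 2 * inner ℝ (x' - x) (x - p) + ‖x - p‖ ^ 2 := by
    rw [← norm_add_sq_real]; congr 2; abel
  have e2 : inner ℝ (x - α • G - x') (p - x')
      = ‖x' - x‖ ^ 2 + inner ℝ (x' - x) (x - p) + α * inner ℝ G (x' - x)
        + α * inner ℝ G (x - p) := by
    have ea : x - α • G - x' = -((x' - x) + α • G) := by module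
    have eb : p - x' = -((x' - x) + (x - p)) := by module
    rw [ea, eb, inner_neg_neg, inner_add_left, inner_add_right, inner_add_right, inner_smul_left,
      inner_smul_left, real_inner_self_eq_norm_sq]
    simp only [conj_trivial]
    ring
  have e3 : inner ℝ (-(G + s)) (x' - x) = - inner ℝ G (x' - x) - inner ℝ s (x' - x) := by
    rw [inner_neg_left, inner_add_left]; ring
  have e4 : inner ℝ (gradient F x) (p - x) = - inner ℝ (gradient F x) (x - p) := by
    rw [← inner_neg_right, neg_sub]
  rw [e2] at h1
  rw [e3] at h6
  rw [e4] at h3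
  rw [inner_sub_left]
  -- Optimal strong convexity at the old point x, with F(x) - F(p) bounded above by the
  -- linearization of F at x.
  have A : 0 ≤ α * (rx - rp - (lam * ‖x - p‖ ^ 2 - inner ℝ (gradient F x) (x - p))) :=
    mul_nonneg hα.le (by linarith)
  -- The proximal inequality involves R(x'); the bounded subgradient at x and the step length O(α)
  -- allow a return to R(x) at total cost O(α²).
  have B : 0 ≤ α * ((K + C) * ((K + C) * α) + inner ℝ G (x' - x) + (r' - rx)) :=
    mul_nonneg hα.le (by linarith)
  nlinarith [sq_nonneg ‖x' - x‖]

end Objective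

/-! ### Measurability of random derivatives and differentiation under the integral. -/

section Measurability

variable {A : Type*} [MeasurableSpace A] {n m : ℕ}

/-- A Carathéodory argument: the derivative is continuous in point and direction, and measurable in
the parameter as a limit of difference quotients. -/
lemma measurable_fderiv_apply_of_contDiff {E F : Type*} [NormedAddCommGroup E] [NormedSpace ℝ E]
    [MeasurableSpace E] [BorelSpace E] [SecondCountableTopology E] [NormedAddCommGroup F]
    [NormedSpace ℝ F] [MeasurableSpace F] [BorelSpace F] {G : A → E → F}
    (hG : ∀ w, ContDiff ℝ 1 (G w)) (hm : ∀ x, StronglyMeasurable fun w => G w x) :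
    Measurable fun p : (E × E) × A => fderiv ℝ (G p.2) p.1.1 p.1.2 := by
  refine measurable_uncurry_of_continuous_of_measurable
    (u := fun (i : E × E) (w : A) => fderiv ℝ (G w) i.1 i.2) (fun w => ?_) (fun i => ?_)
  · exact (((hG w).continuous_fderiv one_ne_zero).comp continuous_fst).clm_apply continuous_snd
  · obtain ⟨x, d⟩ := i
    refine (stronglyMeasurable_of_tendsto (u := Filter.atTop)
      (f := fun (k : ℕ) w => (k : ℝ) • (G w (x + (k : ℝ)⁻¹ • d) - G w x)) (fun k => ?_)
      (tendsto_pi_nhds.2 fun w => ?_)).measurable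
    · exact ((hm _).sub (hm _)).const_smul _
    · refine ((hG w).differentiable one_ne_zero x).hasFDerivAt.lim d ?_
      simpa using tendsto_natCast_atTop_atTop

lemma inner_compGrad {γ : RSpace n → RSpace m} {φ : RSpace m → ℝ} {x h : RSpace n} {y : RSpace m} :
    inner ℝ (compGrad γ φ x y) h = fderiv ℝ φ y (fderiv ℝ γ x h) := by
  rw [compGrad, ContinuousLinearMap.adjoint_inner_left, inner_gradient_left]

lemma norm_compGrad_le {γ : RSpace n → RSpace m} {φ : RSpace m → ℝ} {x : RSpace n} {y : RSpace m}
    {C D : ℝ} (hγ : ‖fderiv ℝ γ x‖ ≤ C) (hφ : ‖gradient φ y‖ ≤ D) : ‖compGrad γ φ x y‖ ≤ C * D := by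
  refine (ContinuousLinearMap.le_opNorm _ _).trans ?_
  rw [LinearIsometryEquiv.norm_map]
  exact mul_le_mul hγ hφ (norm_nonneg _) ((norm_nonneg _).trans hγ)

lemma compGrad_sub (γ : RSpace n → RSpace m) (φ : RSpace m → ℝ) (x : RSpace n) (y u : RSpace m) :
    compGrad γ φ x y - compGrad γ φ x u
      = ContinuousLinearMap.adjoint (fderiv ℝ γ x) (gradient φ y - gradient φ u) := by
  rw [compGrad, compGrad, map_sub]

lemma norm_compGrad_sub_le {γ : RSpace n → RSpace m} {φ : RSpace m → ℝ} {x : RSpace n}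
    {y u : RSpace m} {C L : ℝ} (hγ : ‖fderiv ℝ γ x‖ ≤ C)
    (hφ : ‖gradient φ y - gradient φ u‖ ≤ L * ‖y - u‖) :
    ‖compGrad γ φ x y - compGrad γ φ x u‖ ≤ C * L * ‖y - u‖ := by
  rw [compGrad_sub, mul_assoc]
  refine (ContinuousLinearMap.le_opNorm _ _).trans ?_
  rw [LinearIsometryEquiv.norm_map]
  exact mul_le_mul hγ hφ (norm_nonneg _) ((norm_nonneg _).trans hγ)

lemma RSpace.measurable_of_inner {B : Type*} [MeasurableSpace B] {φ : B → RSpace n}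
    (h : ∀ d, Measurable fun q => inner ℝ (φ q) d) : Measurable φ := by
  have e : φ = fun q => ∑ i, inner ℝ (φ q) (EuclideanSpace.single i (1 : ℝ))
      • EuclideanSpace.single i (1 : ℝ) := by
    funext q
    ext j
    simp [EuclideanSpace.inner_single_right, Pi.single_apply]
  rw [e]
  exact Finset.measurable_fun_sum _ fun i _ => (h _).smul_const _

lemma RSpace.clm_eq_sum {F : Type*} [NormedAddCommGroup F] [NormedSpace ℝ F] (T : RSpace n →L[ℝ] F) :
    T = ∑ i, (EuclideanSpace.proj i : RSpace n →L[ℝ] ℝ).smulRight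
      (T (EuclideanSpace.single i 1)) := by
  ext x
  have hx : x = ∑ i, x i • EuclideanSpace.single i (1 : ℝ) := by
    ext j
    simp [Pi.single_apply]
  conv_lhs => rw [hx]
  simp

/-- In finite dimension an operator is a finite sum built from its values on the basis, so pointwise
measurability lifts to the operator norm, as dominated differentiation requires. -/
lemma RSpace.stronglyMeasurable_clm {F : Type*} [NormedAddCommGroup F] [NormedSpace ℝ F]
    {T : A → RSpace n →L[ℝ] F} (h : ∀ d, StronglyMeasurable fun w => T w d) :
    StronglyMeasurable T := by
  have e : T = fun w => ∑ i, (EuclideanSpace.proj i : RSpace n →L[ℝ] ℝ).smulRight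
      (T w (EuclideanSpace.single i 1)) := funext fun w => RSpace.clm_eq_sum _
  rw [e]
  refine Finset.stronglyMeasurable_fun_sum _ fun i _ => ?_
  exact (ContinuousLinearMap.smulRightL ℝ (RSpace n) F
    (EuclideanSpace.proj i : RSpace n →L[ℝ] ℝ)).continuous.comp_stronglyMeasurable (h _)

/-- Differentiation under the integral sign for `C¹` integrands with bounded derivative. -/
lemma differentiable_integral_of_fderiv_le {F : Type*} [NormedAddCommGroup F] [NormedSpace ℝ F]
    [MeasurableSpace F] [BorelSpace F] [SecondCountableTopology F]
    {ν : Measure A} [IsFiniteMeasure ν] {G : A → RSpace n → F} {C : ℝ}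
    (hG : ∀ w, ContDiff ℝ 1 (G w)) (hm : ∀ x, StronglyMeasurable fun w => G w x)
    (hi : ∀ x, Integrable (fun w => G w x) ν) (hb : ∀ᵐ w ∂ν, ∀ x, ‖fderiv ℝ (G w) x‖ ≤ C) :
    Differentiable ℝ fun x => ∫ w, G w x ∂ν := by
  intro x
  refine (hasFDerivAt_integral_of_dominated_of_fderiv_le (s := Set.univ)
    (F := fun x w => G w x) (F' := fun x w => fderiv ℝ (G w) x) (bound := fun _ => C)
    Filter.univ_mem (.of_forall fun y => (hm y).aestronglyMeasurable) (hi x) ?_ ?_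
    (integrable_const _) ?_).differentiableAt
  · refine (RSpace.stronglyMeasurable_clm fun d => ?_).aestronglyMeasurable
    exact ((measurable_fderiv_apply_of_contDiff hG hm).comp
      (measurable_const (a := (x, d)).prodMk measurable_id)).stronglyMeasurable
  · filter_upwards [hb] with w hw y _ using hw y
  · exact .of_forall fun w y _ => ((hG w).differentiable one_ne_zero y).hasFDerivAt

end Measurability

/-! ### Regularity of the mean functions g, f and F. -/

section Problem

variable {W V : Type*} [MeasurableSpace W] [MeasurableSpace V] {n m : ℕ}
  {P : Measure (W × V)} {f : V → RSpace m → ℝ} {g : W → RSpace n → RSpace m} {R : RSpace n → EReal}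

lemma ProblemData.measurable_compGrad (h : ProblemData P f g R) :
    Measurable fun q : (W × V) × RSpace n × RSpace m =>
      compGrad (g q.1.1) (f q.1.2) q.2.1 q.2.2 := by
  refine RSpace.measurable_of_inner fun d => ?_
  simp_rw [inner_compGrad]
  have h1 := measurable_fderiv_apply_of_contDiff h.f_contDiff fun y => (h.f_meas y).stronglyMeasurable
  have h2 := measurable_fderiv_apply_of_contDiff h.g_contDiff fun y => (h.g_meas y).stronglyMeasurable
  have h3 : Measurable fun q : (W × V) × RSpace n × RSpace m => fderiv ℝ (g q.1.1) q.2.1 d :=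
    h2.comp (((by fun_prop : Measurable fun q : (W × V) × RSpace n × RSpace m => q.2.1).prodMk
      measurable_const).prodMk (by fun_prop : Measurable fun q : (W × V) × RSpace n × RSpace m => q.1.1))
  exact h1.comp (((by fun_prop : Measurable fun q : (W × V) × RSpace n × RSpace m => q.2.2).prodMk
      h3).prodMk (by fun_prop : Measurable fun q : (W × V) × RSpace n × RSpace m => q.1.2))

lemma ProblemData.measurable_inner (h : ProblemData P f g R) :
    Measurable fun q : (W × V) × RSpace n => g q.1.1 q.2 := by
  have := measurable_uncurry_of_continuous_of_measurable
    (u := fun (x : RSpace n) (w : W) => g w x) (fun w => (h.g_contDiff w).continuous) h.g_meas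
  exact this.comp ((by fun_prop : Measurable fun q : (W × V) × RSpace n => q.2).prodMk
    (by fun_prop : Measurable fun q : (W × V) × RSpace n => q.1.1))

variable {C : ℝ} [IsProbabilityMeasure P]

lemma ProblemData.differentiable_meanInner (h : ProblemData P f g R)
    (hb : BoundedGradients P f g R C) : Differentiable ℝ (meanInner P g) :=
  differentiable_integral_of_fderiv_le (G := fun (p : W × V) x => g p.1 x) (C := C)
    (fun p => h.g_contDiff p.1)
    (fun x => ((h.g_meas x).comp measurable_fst).stronglyMeasurable) h.g_int hb.inner

lemma ProblemData.differentiable_meanOuter (h : ProblemData P f g R)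
    (hb : BoundedGradients P f g R C) : Differentiable ℝ (meanOuter P f) := by
  refine differentiable_integral_of_fderiv_le (G := fun (p : W × V) x => f p.2 x) (C := C)
    (fun p => h.f_contDiff p.2)
    (fun x => ((h.f_meas x).comp measurable_snd).stronglyMeasurable) h.f_int ?_
  filter_upwards [hb.outer] with p hp y
  simpa [gradient] using hp y

lemma ProblemData.differentiable_smoothPart (h : ProblemData P f g R)
    (hb : BoundedGradients P f g R C) : Differentiable ℝ (smoothPart P f g) :=
  (h.differentiable_meanOuter hb).comp (h.differentiable_meanInner hb)

lemma ProblemData.gradient_smoothPart (h : ProblemData P f g R)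
    (hb : BoundedGradients P f g R C) (x : RSpace n) :
    gradient (smoothPart P f g) x
      = compGrad (meanInner P g) (meanOuter P f) x (meanInner P g x) := by
  refine ext_inner_right ℝ fun d => ?_
  rw [inner_gradient_left, inner_compGrad]
  have : fderiv ℝ (smoothPart P f g) x = _ :=
    fderiv_comp x (h.differentiable_meanOuter hb _) (h.differentiable_meanInner hb x)
  rw [this]
  rfl

lemma ProblemData.measurable_gradient_smoothPart (P : Measure (W × V)) (f : V → RSpace m → ℝ)
    (g : W → RSpace n → RSpace m) : Measurable (gradient (smoothPart P f g)) :=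
  (InnerProductSpace.toDual ℝ (RSpace n)).symm.continuous.measurable.comp (measurable_fderiv ℝ _)

end Problem

/-! ### Recursions with polynomially decaying steps. -/

section Rates

open Filter

/-- Induction on u ≤ c r: the step closes once A ≤ c(1-θ), because the decay of r uses only the
fraction θ of the contraction κ and the rest absorbs the source. -/
lemma le_mul_of_recursion {u r κ : ℕ → ℝ} {A θ : ℝ} {K : ℕ} (hθ : θ < 1)
    (hr : ∀ k ≥ K, 0 < r k) (hκ0 : ∀ k ≥ K, 0 ≤ κ k) (hκ1 : ∀ k ≥ K, κ k ≤ 1)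
    (hdecay : ∀ k ≥ K, (1 - θ * κ k) * r k ≤ r (k + 1))
    (hu : ∀ k ≥ K, u (k + 1) ≤ (1 - κ k) * u k + A * κ k * r k) :
    ∃ c, 0 ≤ c ∧ ∀ k ≥ K, u k ≤ c * r k := by
  refine ⟨max 0 (max (A / (1 - θ)) (u K / r K)), le_max_left _ _, fun k hk => ?_⟩
  set c := max 0 (max (A / (1 - θ)) (u K / r K))
  have hc0 : 0 ≤ c := le_max_left _ _
  have hcA : A ≤ c * (1 - θ) :=
    (div_le_iff₀ (by linarith)).1 ((le_max_left _ _).trans (le_max_right _ _))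
  induction k, hk using Nat.le_induction with
  | base => exact (div_le_iff₀ (hr K le_rfl)).1 ((le_max_right _ _).trans (le_max_right _ _))
  | succ k hk ih =>
    have h1 : (1 - κ k) * u k ≤ (1 - κ k) * (c * r k) :=
      mul_le_mul_of_nonneg_left ih (by linarith [hκ1 k hk])
    have h2 : A * (κ k * r k) ≤ c * (1 - θ) * (κ k * r k) :=
      mul_le_mul_of_nonneg_right hcA (mul_nonneg (hκ0 k hk) (hr k hk).le)
    have h3 : c * ((1 - θ * κ k) * r k) ≤ c * r (k + 1) :=
      mul_le_mul_of_nonneg_left (hdecay k hk) hc0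
    linarith [hu k hk]

lemma exists_pos_forall_le_mul {u r : ℕ → ℝ} (hr : ∀ k ≥ 1, 0 < r k) {K : ℕ} {c : ℝ}
    (h : ∀ k ≥ K, u k ≤ c * r k) : ∃ c' : ℝ, 0 < c' ∧ ∀ k ≥ 1, u k ≤ c' * r k := by
  refine ⟨1 + |c| + ∑ i ∈ Finset.range K, |u i / r i|, by positivity, fun k hk => ?_⟩
  have hs : 0 ≤ ∑ i ∈ Finset.range K, |u i / r i| := by positivity
  rcases le_or_gt K k with hKk | hkK
  · refine (h k hKk).trans (mul_le_mul_of_nonneg_right ?_ (hr k hk).le)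
    linarith [le_abs_self c]
  · rw [← div_le_iff₀ (hr k hk)]
    have := Finset.single_le_sum (f := fun i => |u i / r i|) (fun i _ => abs_nonneg _)
      (Finset.mem_range.2 hkK)
    have h2 := le_abs_self (u k / r k)
    linarith [abs_nonneg c]

lemma tendsto_natCast_rpow_neg {q : ℝ} (hq : 0 < q) :
    Tendsto (fun k : ℕ => (k : ℝ) ^ (-q)) atTop (nhds 0) :=
  (tendsto_rpow_neg_atTop hq).comp tendsto_natCast_atTop_atTop

/-- A Chung-type lemma: a recursion with contraction factor `1 - B k^{-q}` and source
`A B k^{-q} r_k` has solutions of order `r_k` when `r` decays slower than the homogeneous part. -/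
lemma exists_rate_bound {u r : ℕ → ℝ} {A B q θ : ℝ} (hθ : θ < 1) (hB : 0 < B) (hq : 0 < q)
    (hr : ∀ k ≥ 1, 0 < r k)
    (hdecay : ∀ᶠ k : ℕ in atTop, (1 - θ * (B * (k : ℝ) ^ (-q))) * r k ≤ r (k + 1))
    (hu : ∀ᶠ k : ℕ in atTop, u (k + 1)
      ≤ (1 - B * (k : ℝ) ^ (-q)) * u k + A * (B * (k : ℝ) ^ (-q)) * r k) :
    ∃ c : ℝ, 0 < c ∧ ∀ k ≥ 1, u k ≤ c * r k := by
  have hlim : Tendsto (fun k : ℕ => B * (k : ℝ) ^ (-q)) atTop (nhds 0) := by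
    simpa using (tendsto_natCast_rpow_neg hq).const_mul B
  have h1 : ∀ᶠ k : ℕ in atTop, B * (k : ℝ) ^ (-q) ≤ 1 := hlim.eventually_le_const one_pos
  obtain ⟨K, hK⟩ := eventually_atTop.1 ((hdecay.and hu).and (h1.and (eventually_ge_atTop 1)))
  obtain ⟨c, -, hc⟩ := le_mul_of_recursion (u := u) (r := r) (κ := fun k => B * (k : ℝ) ^ (-q))
    (A := A) (K := K) hθ (fun k hk => hr k (hK k hk).2.2)
    (fun k _ => mul_nonneg hB.le (by positivity)) (fun k hk => (hK k hk).2.1)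
    (fun k hk => (hK k hk).1.1) (fun k hk => (hK k hk).1.2)
  exact exists_pos_forall_le_mul hr hc

/-- For s ≥ 0 this is (1+1/x)^{-s} ≥ 1 - s log(1+1/x) ≥ 1 - s/x; for s ≤ 0 it is monotonicity. -/
lemma one_sub_div_mul_rpow_le {s x : ℝ} (hx : 0 < x) :
    (1 - max s 0 / x) * x ^ (-s) ≤ (x + 1) ^ (-s) := by
  rcases le_total s 0 with hs | hs
  · rw [max_eq_right hs, zero_div, sub_zero, one_mul]
    exact Real.rpow_le_rpow hx.le (by linarith) (by linarith)
  · rw [max_eq_left hs]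
    have h1 : (x + 1) ^ (-s) = (1 + 1 / x) ^ (-s) * x ^ (-s) := by
      rw [← Real.mul_rpow (by positivity) hx.le]
      congr 1
      field_simp
    rw [h1]
    refine mul_le_mul_of_nonneg_right ?_ (by positivity)
    have h2 : Real.log (1 + 1 / x) ≤ 1 / x := by
      have := Real.log_le_sub_one_of_pos (show 0 < 1 + 1 / x by positivity)
      linarith
    rw [Real.rpow_def_of_pos (by positivity)]
    have h3 := Real.add_one_le_exp (Real.log (1 + 1 / x) * -s)
    have h4 : s * Real.log (1 + 1 / x) ≤ s * (1 / x) := mul_le_mul_of_nonneg_left h2 hs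
    have h5 : s / x = s * (1 / x) := by ring
    linarith

/-- One step costs k^{-s} a relative amount of at most max(s, 0)/k. This is eventually below D
k^{-q} when q < 1, and requires s ≤ D when q = 1. -/
lemma eventually_rpow_decay {s q D : ℝ} (hD : 0 < D) (hq1 : q ≤ 1) (hs : q = 1 → s ≤ D) :
    ∀ᶠ k : ℕ in atTop, (1 - D * (k : ℝ) ^ (-q)) * (k : ℝ) ^ (-s) ≤ ((k + 1 : ℕ) : ℝ) ^ (-s) := by
  have h : ∀ᶠ k : ℕ in atTop, max s 0 ≤ D * (k : ℝ) ^ (1 - q) := by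
    rcases hq1.eq_or_lt with rfl | hq
    · refine .of_forall fun k => ?_
      simpa using ⟨hs rfl, hD.le⟩
    · have : Tendsto (fun k : ℕ => D * (k : ℝ) ^ (1 - q)) atTop atTop :=
        ((tendsto_rpow_atTop (by linarith : 0 < 1 - q)).comp
          tendsto_natCast_atTop_atTop).const_mul_atTop hD
      exact this.eventually_ge_atTop _
  filter_upwards [h, eventually_ge_atTop 1] with k hk hk1
  have hk0 : (0 : ℝ) < k := by exact_mod_cast hk1
  have h1 : D * (k : ℝ) ^ (-q) = D * (k : ℝ) ^ (1 - q) / k := by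
    rw [show (1 - q) = 1 + -q by ring, Real.rpow_add hk0, Real.rpow_one]
    field_simp
  rw [h1]
  push_cast
  refine le_trans (mul_le_mul_of_nonneg_right ?_ (by positivity)) (one_sub_div_mul_rpow_le hk0)
  exact sub_le_sub_left (div_le_div_of_nonneg_right hk hk0.le) _

lemma rpow_neg_min_le (p q : ℝ) {k : ℕ} (hk : 1 ≤ k) :
    (k : ℝ) ^ (-min p q) ≤ (k : ℝ) ^ (-p) + (k : ℝ) ^ (-q) := by
  have h1 : 0 ≤ (k : ℝ) ^ (-p) := by positivity
  have h2 : 0 ≤ (k : ℝ) ^ (-q) := by positivity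
  rcases min_choice p q with h | h <;> rw [h] <;> linarith

end Rates

lemma MeasureTheory.MemLp.integrable_inner_of_two {Ω : Type*} [MeasurableSpace Ω]
    {μ : Measure Ω} {E : Type*} [NormedAddCommGroup E]
    [InnerProductSpace ℝ E] {X Y : Ω → E} (hX : MemLp X 2 μ) (hY : MemLp Y 2 μ) :
    Integrable (fun ω => (inner ℝ (X ω) (Y ω) : ℝ)) μ := by
  refine ((hX.integrable_norm_pow two_ne_zero).add (hY.integrable_norm_pow two_ne_zero)).mono'
    (hX.aestronglyMeasurable.inner hY.aestronglyMeasurable) (.of_forall fun ω => ?_)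
  have h1 := norm_inner_le_norm (𝕜 := ℝ) (X ω) (Y ω)
  have h2 := two_mul_le_add_sq ‖X ω‖ ‖Y ω‖
  simp only [Pi.add_apply]
  nlinarith [mul_nonneg (norm_nonneg (X ω)) (norm_nonneg (Y ω))]

/-! ### Expectations involving an independent fresh sample. -/

section Independence

variable {Ω A B : Type*} [MeasurableSpace Ω] [MeasurableSpace A] [MeasurableSpace B]
  {μ : Measure Ω} [IsProbabilityMeasure μ] {P : Measure B} [IsProbabilityMeasure P]
  {X : Ω → A} {Z : Ω → B}

/-- Plays the role of conditioning on X: the law of (X, Z) is a product, and Fubini integrates Z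
first. -/
lemma integral_eq_zero_of_indepFun (hX : Measurable X) (hZ : Measurable Z) (h : IndepFun X Z μ)
    (hlaw : μ.map Z = P) {φ : A × B → ℝ} (hφ : Measurable φ)
    (hi : Integrable (fun ω => φ (X ω, Z ω)) μ) (h0 : ∀ a, ∫ b, φ (a, b) ∂P = 0) :
    ∫ ω, φ (X ω, Z ω) ∂μ = 0 := by
  have hmap : μ.map (fun ω => (X ω, Z ω)) = (μ.map X).prod P := by
    rw [← hlaw]
    exact h.map_prod_eq_prod_map_map hX.aemeasurable hZ.aemeasurable
  have := Measure.isProbabilityMeasure_map (μ := μ) hX.aemeasurable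
  rw [← integral_map (φ := fun ω => (X ω, Z ω)) (f := φ) (hX.prodMk hZ).aemeasurable
    hφ.aestronglyMeasurable, hmap, integral_prod]
  · simp [h0]
  · rw [← hmap]
    exact (integrable_map_measure hφ.aestronglyMeasurable (hX.prodMk hZ).aemeasurable).2 hi

lemma integral_le_of_indepFun (hX : Measurable X) (hZ : Measurable Z) (h : IndepFun X Z μ)
    (hlaw : μ.map Z = P) {φ : A × B → ℝ} (hφ : Measurable φ) (hφ0 : ∀ q, 0 ≤ φ q) {s : ℝ}
    (hi : ∀ a, Integrable (fun b => φ (a, b)) P) (hs : ∀ a, ∫ b, φ (a, b) ∂P ≤ s) :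
    Integrable (fun ω => φ (X ω, Z ω)) μ ∧ ∫ ω, φ (X ω, Z ω) ∂μ ≤ s := by
  have hmap : μ.map (fun ω => (X ω, Z ω)) = (μ.map X).prod P := by
    rw [← hlaw]
    exact h.map_prod_eq_prod_map_map hX.aemeasurable hZ.aemeasurable
  have := Measure.isProbabilityMeasure_map (μ := μ) hX.aemeasurable
  have hn : ∀ a, ∫ b, ‖φ (a, b)‖ ∂P = ∫ b, φ (a, b) ∂P := fun a =>
    integral_congr_ae (.of_forall fun b => Real.norm_of_nonneg (hφ0 _))
  have hm : StronglyMeasurable fun a => ∫ b, φ (a, b) ∂P :=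
    StronglyMeasurable.integral_prod_right' (f := φ) hφ.stronglyMeasurable
  have hint : Integrable (fun a => ∫ b, φ (a, b) ∂P) (μ.map X) :=
    Integrable.of_bound hm.aestronglyMeasurable s (.of_forall fun a => by
      rw [Real.norm_of_nonneg (integral_nonneg fun b => hφ0 _)]
      exact hs a)
  have hprod : Integrable φ ((μ.map X).prod P) := by
    refine (integrable_prod_iff hφ.aestronglyMeasurable).2 ⟨.of_forall hi, ?_⟩
    simpa only [hn] using hint
  refine ⟨?_, ?_⟩
  · refine (integrable_map_measure hφ.aestronglyMeasurable (hX.prodMk hZ).aemeasurable).1 ?_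
    rwa [hmap]
  · rw [← integral_map (φ := fun ω => (X ω, Z ω)) (f := φ) (hX.prodMk hZ).aemeasurable
      hφ.aestronglyMeasurable, hmap, integral_prod _ hprod]
    refine (integral_mono hint (integrable_const s) hs).trans ?_
    simp

lemma memLp_comp_of_ae_bounded {n : ℕ} {E : Type*} [NormedAddCommGroup E] [MeasurableSpace E]
    [BorelSpace E] [SecondCountableTopology E] {X : Ω → RSpace n} (hX : Measurable X)
    {b : ℝ} (hb : ∀ᵐ ω ∂μ, ‖X ω‖ ≤ b) {φ : RSpace n → E} (hφ : Continuous φ) (p : ENNReal) :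
    MemLp (fun ω => φ (X ω)) p μ := by
  obtain ⟨c, hc⟩ := (isCompact_closedBall (0 : RSpace n) b).exists_bound_of_continuousOn
    hφ.continuousOn
  refine MemLp.of_bound (hφ.measurable.comp hX).aestronglyMeasurable c ?_
  filter_upwards [hb] with ω hω
  exact hc _ (by simpa using hω)

end Independence

/-- Since x' = (1-β)x + βz, the linear terms at x' cancel and only second-order remainders are left.
Their weights (1-β) + β(1-1/β)² add up to (1-β)/β. -/
lemma norm_extrapolation_error_le {n m : ℕ} {γ : RSpace n → RSpace m} {L β : ℝ} (hL : 0 ≤ L)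
    (hγ : ∀ x z, ‖γ x - γ z - fderiv ℝ γ z (x - z)‖ ≤ L / 2 * ‖x - z‖ ^ 2)
    (hβ0 : 0 < β) (hβ1 : β ≤ 1) {x x' z : RSpace n}
    (hz : z = (1 - 1 / β) • x + (1 / β) • x') :
    ‖(1 - β) • (γ x - γ x') + β • (γ z - γ x')‖ ≤ L / 2 * ‖x' - x‖ ^ 2 / β := by
  have h0 : z - x' = (1 - 1 / β) • (x - x') := by rw [hz]; module
  have h1 : (1 - β) • fderiv ℝ γ x' (x - x') + β • fderiv ℝ γ x' (z - x') = 0 := by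
    rw [h0, map_smul, smul_smul, ← add_smul]
    have : 1 - β + β * (1 - 1 / β) = 0 := by field_simp; ring
    rw [this, zero_smul]
  have e : (1 - β) • (γ x - γ x') + β • (γ z - γ x')
      = (1 - β) • (γ x - γ x' - fderiv ℝ γ x' (x - x'))
        + β • (γ z - γ x' - fderiv ℝ γ x' (z - x')) := by
    rw [← sub_eq_zero, ← h1]; module
  have h2 := hγ x x'
  have h3 := hγ z x'
  rw [h0, norm_smul, mul_pow, ← h0, Real.norm_eq_abs, sq_abs] at h3
  rw [e]
  refine (norm_add_le _ _).trans ?_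
  rw [norm_smul, norm_smul, Real.norm_of_nonneg (by linarith : 0 ≤ 1 - β), Real.norm_of_nonneg hβ0.le,
    norm_sub_rev x' x]
  have h4 := mul_le_mul_of_nonneg_left h2 (by linarith : 0 ≤ 1 - β)
  have h5 := mul_le_mul_of_nonneg_left h3 hβ0.le
  have h6 : (1 - β) * (L / 2 * ‖x - x'‖ ^ 2) + β * (L / 2 * ((1 - 1 / β) ^ 2 * ‖x - x'‖ ^ 2))
      = L / 2 * ‖x - x'‖ ^ 2 * (1 - β) / β := by
    field_simp; ring
  refine (add_le_add h4 h5).trans (h6.trans_le (div_le_div_of_nonneg_right ?_ hβ0.le))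
  have : 0 ≤ L / 2 * ‖x - x'‖ ^ 2 := by positivity
  nlinarith

/-- Convexity of the squared norm applied to (1-β)u + β(r/β). -/
lemma norm_convex_combo_add_sq_le {E : Type*} [NormedAddCommGroup E] [InnerProductSpace ℝ E]
    {β : ℝ} (hβ0 : 0 < β) (hβ1 : β ≤ 1) (u r : E) :
    ‖(1 - β) • u + r‖ ^ 2 ≤ (1 - β) * ‖u‖ ^ 2 + ‖r‖ ^ 2 / β := by
  have h := real_inner_le_norm u r
  have h1 : 0 ≤ (β * ‖u‖ - ‖r‖) ^ 2 * (1 - β) / β :=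
    div_nonneg (mul_nonneg (sq_nonneg _) (by linarith)) hβ0.le
  have h2 : (β * ‖u‖ - ‖r‖) ^ 2 * (1 - β) / β = (1 - β) * ‖u‖ ^ 2 + ‖r‖ ^ 2 / β
      - ((1 - β) ^ 2 * ‖u‖ ^ 2 + 2 * ((1 - β) * (‖u‖ * ‖r‖)) + ‖r‖ ^ 2) := by
    field_simp; ring
  rw [norm_add_sq_real, norm_smul, inner_smul_left, mul_pow, Real.norm_eq_abs, sq_abs]
  simp only [conj_trivial]
  have h3 := mul_le_mul_of_nonneg_left h (by linarith : 0 ≤ 1 - β)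
  linarith

/-- The σ-algebra generated by the first samples `ζ 0, …, ζ k`. -/
abbrev samplePast {Ω B : Type*} [mB : MeasurableSpace B] (ζ : ℕ → Ω → B) (k : ℕ) :
    MeasurableSpace Ω :=
  ⨆ i ∈ Set.Iic k, mB.comap (ζ i)

lemma measurable_sample {Ω B : Type*} [mB : MeasurableSpace B] (ζ : ℕ → Ω → B) (k : ℕ) :
    Measurable[samplePast ζ k] (ζ k) :=
  measurable_iff_comap_le.2 (le_iSup₂_of_le (f := fun i (_ : i ∈ Set.Iic k) => mB.comap (ζ i)) k
    (Set.mem_Iic.2 le_rfl) le_rfl)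

lemma samplePast_mono {Ω B : Type*} [mB : MeasurableSpace B] (ζ : ℕ → Ω → B) :
    Monotone (samplePast ζ) :=
  fun _ _ h => biSup_mono fun _ hi => le_trans hi h

/-! ### Adaptedness, boundedness and tracking error of the iterates. -/

section Algorithm

variable {W V Ω : Type*} [MeasurableSpace W] [MeasurableSpace V] [MeasurableSpace Ω] {n m : ℕ}

/-- A run of the method on a problem with bounded gradients, with positive step sizes `α`. -/
structure BoundedRun (P : Measure (W × V)) (f : V → RSpace m → ℝ) (g : W → RSpace n → RSpace m)
    (R : RSpace n → EReal) (C : ℝ) (α β : ℕ → ℝ) (μ : Measure Ω) (ζ : ℕ → Ω → W × V)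
    (x₁ z₁ : RSpace n) (y₀ : RSpace m) (β₀ : ℝ)
    (x z : ℕ → Ω → RSpace n) (y : ℕ → Ω → RSpace m) : Prop where
  data : ProblemData P f g R
  grads : BoundedGradients P f g R C
  samples : OracleSamples μ P ζ
  iterates : IsASCPG f g R α β ζ x₁ z₁ y₀ β₀ x z y
  step_pos : ∀ k, 1 ≤ k → 0 < α k

variable {P : Measure (W × V)} {f : V → RSpace m → ℝ} {g : W → RSpace n → RSpace m}
  {R : RSpace n → EReal} {C : ℝ} {α β : ℕ → ℝ} {μ : Measure Ω} {ζ : ℕ → Ω → W × V}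
  {x₁ z₁ : RSpace n} {y₀ : RSpace m} {β₀ : ℝ}
  {x z : ℕ → Ω → RSpace n} {y : ℕ → Ω → RSpace m}

lemma OracleSamples.samplePast_le (h : OracleSamples μ P ζ) (k : ℕ) :
    samplePast ζ k ≤ ‹MeasurableSpace Ω› :=
  iSup₂_le fun i _ => (h.meas i).comap_le

lemma OracleSamples.indepFun_succ (h : OracleSamples μ P ζ) {E : Type*} [MeasurableSpace E]
    {k : ℕ} {X : Ω → E} (hX : Measurable[samplePast ζ k] X) : IndepFun X (ζ (k + 1)) μ := by
  have h1 := indep_iSup_of_disjoint (fun i => (h.meas i).comap_le) h.indep.iIndep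
    (S := Set.Iic k) (T := {k + 1}) (by simp)
  rw [iSup_singleton] at h1
  exact (IndepFun_iff_Indep _ _ _).2 (indep_of_indep_of_le_left h1 hX.comap_le)

lemma OracleSamples.ae_sample (h : OracleSamples μ P ζ) {p : W × V → Prop} (hp : ∀ᵐ q ∂P, p q) :
    ∀ᵐ ω ∂μ, ∀ k, 1 ≤ k → p (ζ k ω) := by
  refine ae_all_iff.2 fun k => ?_
  by_cases hk : 1 ≤ k
  · have := ae_of_ae_map (h.meas k).aemeasurable (p := p) (by rwa [h.law k hk])
    filter_upwards [this] with ω hω _ using hω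
  · exact .of_forall fun ω hk' => absurd hk' hk

namespace BoundedRun

/-- The index shift is essential: x_{k+1} and z_{k+1} depend on samples up to k only, whereas
y_{k+1} already contains w_{k+1}. -/
lemma measurable_iterates (h : BoundedRun P f g R C α β μ ζ x₁ z₁ y₀ β₀ x z y) (k : ℕ) :
    Measurable[samplePast ζ k] (x (k + 1)) ∧ Measurable[samplePast ζ k] (z (k + 1)) ∧
      Measurable[samplePast ζ (k + 1)] (y (k + 1)) := by
  induction k with
  | zero =>
    have hx : x 1 = fun _ => x₁ := funext h.iterates.x_init
    have hz : z 1 = fun _ => z₁ := funext h.iterates.z_init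
    have hy : y 1 = fun ω => (1 - β₀) • y₀ + β₀ • g (ζ 1 ω).1 z₁ :=
      funext fun ω => by rw [h.iterates.y_init, h.iterates.z_init]
    refine ⟨?_, ?_, ?_⟩
    · rw [zero_add, hx]; exact measurable_const
    · rw [zero_add, hz]; exact measurable_const
    · rw [zero_add, hy]
      have h1 : Measurable[samplePast ζ 1] fun ω => g (ζ 1 ω).1 z₁ :=
        (h.data.g_meas z₁).comp (measurable_fst.comp (measurable_sample ζ 1))
      exact (h1.const_smul β₀).const_add _
  | succ k ih =>
    obtain ⟨hx, -, hy⟩ := ih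
    have hx' : Measurable[samplePast ζ (k + 1)] (x (k + 1)) :=
      hx.mono (samplePast_mono ζ k.le_succ) le_rfl
    obtain ⟨T, hT, hTx⟩ := exists_continuous_prox h.data.R_closedConvex
      (h.step_pos (k + 1) (Nat.le_add_left 1 k))
    have hG : Measurable[samplePast ζ (k + 1)] fun ω => compGrad (g (ζ (k + 1) ω).1)
        (f (ζ (k + 1) ω).2) (x (k + 1) ω) (y (k + 1) ω) := by
      have := h.data.measurable_compGrad.comp
        ((measurable_sample ζ (k + 1)).prodMk (hx'.prodMk hy))
      exact this
    have hx2 : Measurable[samplePast ζ (k + 1)] (x (k + 1 + 1)) := by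
      have e : x (k + 1 + 1) = fun ω => T (x (k + 1) ω - α (k + 1) • compGrad (g (ζ (k + 1) ω).1)
        (f (ζ (k + 1) ω).2) (x (k + 1) ω) (y (k + 1) ω)) :=
        funext fun ω => hTx _ _ (h.iterates.x_step (k + 1) (Nat.le_add_left 1 k) ω)
      rw [e]
      exact hT.measurable.comp (hx'.sub (hG.const_smul (α (k + 1))))
    have hz2 : Measurable[samplePast ζ (k + 1)] (z (k + 1 + 1)) := by
      rw [funext (h.iterates.z_step (k + 1) (Nat.le_add_left 1 k))]
      exact (hx'.const_smul (1 - 1 / β (k + 1))).add (hx2.const_smul (1 / β (k + 1)))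
    refine ⟨hx2, hz2, ?_⟩
    rw [funext (h.iterates.y_step (k + 1) (Nat.le_add_left 1 k))]
    have hle := samplePast_mono ζ (k + 1).le_succ
    have h1 : Measurable[samplePast ζ (k + 1 + 1)] fun ω =>
        g (ζ (k + 1 + 1) ω).1 (z (k + 1 + 1) ω) :=
      h.data.measurable_inner.comp ((measurable_sample ζ (k + 1 + 1)).prodMk (hz2.mono hle le_rfl))
    have hy' : Measurable[samplePast ζ (k + 1 + 1)] (y (k + 1)) := hy.mono hle le_rfl
    exact (hy'.const_smul (1 - β (k + 1))).add (h1.const_smul (β (k + 1)))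

lemma measurable_x (h : BoundedRun P f g R C α β μ ζ x₁ z₁ y₀ β₀ x z y) {k : ℕ} (hk : 1 ≤ k) :
    Measurable (x k) := by
  obtain ⟨j, rfl⟩ := Nat.exists_eq_add_of_le' hk
  exact (h.measurable_iterates j).1.mono (h.samples.samplePast_le _) le_rfl

lemma measurable_z (h : BoundedRun P f g R C α β μ ζ x₁ z₁ y₀ β₀ x z y) {k : ℕ} (hk : 1 ≤ k) :
    Measurable (z k) := by
  obtain ⟨j, rfl⟩ := Nat.exists_eq_add_of_le' hk
  exact (h.measurable_iterates j).2.1.mono (h.samples.samplePast_le _) le_rfl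

lemma ne_top (h : BoundedRun P f g R C α β μ ζ x₁ z₁ y₀ β₀ x z y) {k : ℕ} (hk : 2 ≤ k) (ω : Ω) :
    R (x k ω) ≠ ⊤ := by
  obtain ⟨j, rfl⟩ := Nat.exists_eq_add_of_le' hk
  exact (h.iterates.x_step (j + 1) (Nat.le_add_left 1 j) ω).ne_top h.data.R_closedConvex
    (h.step_pos _ (Nat.le_add_left 1 j))

lemma ae_norm_compGrad_le (h : BoundedRun P f g R C α β μ ζ x₁ z₁ y₀ β₀ x z y) :
    ∀ᵐ ω ∂μ, ∀ k, 1 ≤ k → ∀ u v, ‖compGrad (g (ζ k ω).1) (f (ζ k ω).2) u v‖ ≤ C * C :=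
  h.samples.ae_sample (p := fun q => ∀ u v, ‖compGrad (g q.1) (f q.2) u v‖ ≤ C * C) (by
    filter_upwards [h.grads.inner, h.grads.outer] with q h1 h2 u v
    exact norm_compGrad_le (h1 u) (h2 v))

/-- The index starts at 2 because R may be infinite at the arbitrary point x₁; later iterates are
proximal points, where a bounded subgradient exists. -/
lemma ae_norm_step_le (h : BoundedRun P f g R C α β μ ζ x₁ z₁ y₀ β₀ x z y) :
    ∀ᵐ ω ∂μ, ∀ k, 2 ≤ k → ‖x (k + 1) ω - x k ω‖ ≤ (C * C + C) * α k := by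
  filter_upwards [h.ae_norm_compGrad_le] with ω hω k hk
  obtain ⟨s, hs, hsC⟩ := h.grads.penalty _ (h.ne_top hk ω)
  have hk1 : 1 ≤ k := by omega
  have h1 := (h.iterates.x_step k hk1 ω).norm_sub_le_of_isSubgradient hs h.data.R_closedConvex
    (h.step_pos k hk1)
  have h2 := hω k hk1 (x k ω) (y k ω)
  set G := compGrad (g (ζ k ω).1) (f (ζ k ω).2) (x k ω) (y k ω)
  have e : x k ω - α k • G - x k ω - α k • s = -(α k • (G + s)) := by module
  rw [e, norm_neg, norm_smul, Real.norm_eq_abs, abs_of_pos (h.step_pos k hk1)] at h1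
  nlinarith [norm_add_le G s, h.step_pos k hk1]

/-- The bound may grow with k; it serves only integrability. It comes from comparison with a fixed q
that is the proximal point of q + α s. -/
lemma exists_ae_norm_x_le (h : BoundedRun P f g R C α β μ ζ x₁ z₁ y₀ β₀ x z y) {k : ℕ}
    (hk : 1 ≤ k) : ∃ b, ∀ᵐ ω ∂μ, ‖x k ω‖ ≤ b := by
  induction k, hk using Nat.le_induction with
  | base => exact ⟨‖x₁‖, .of_forall fun ω => by rw [h.iterates.x_init]⟩
  | succ k hk ih =>
    obtain ⟨b, hb⟩ := ih
    obtain ⟨q, hq⟩ := h.data.R_closedConvex.proper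
    obtain ⟨s, hs, -⟩ := h.grads.penalty q hq
    refine ⟨b + α k * (C * C) + ‖q + α k • s‖ + ‖q‖, ?_⟩
    filter_upwards [hb, h.ae_norm_compGrad_le] with ω h1 h2
    have h3 := (h.iterates.x_step k hk ω).norm_sub_le_of_isSubgradient hs h.data.R_closedConvex
      (h.step_pos k hk)
    have h4 := h2 k hk (x k ω) (y k ω)
    set G := compGrad (g (ζ k ω).1) (f (ζ k ω).2) (x k ω) (y k ω)
    have h5 : ‖x k ω - α k • G - q - α k • s‖ ≤ ‖x k ω‖ + α k * ‖G‖ + ‖q + α k • s‖ := by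
      rw [sub_sub _ q]
      refine (norm_sub_le _ _).trans (add_le_add_left ((norm_sub_le _ _).trans ?_) _)
      rw [norm_smul, Real.norm_eq_abs, abs_of_pos (h.step_pos k hk)]
    have h6 : ‖x (k + 1) ω‖ ≤ ‖x (k + 1) ω - q‖ + ‖q‖ := norm_le_norm_sub_add _ _
    have h7 := mul_le_mul_of_nonneg_left h4 (h.step_pos k hk).le
    linarith

lemma exists_ae_norm_z_le (h : BoundedRun P f g R C α β μ ζ x₁ z₁ y₀ β₀ x z y) {k : ℕ}
    (hk : 1 ≤ k) : ∃ b, ∀ᵐ ω ∂μ, ‖z k ω‖ ≤ b := by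
  rcases hk.eq_or_lt with rfl | hk
  · exact ⟨‖z₁‖, .of_forall fun ω => by rw [h.iterates.z_init]⟩
  · obtain ⟨j, rfl⟩ := Nat.exists_eq_add_of_le' hk
    obtain ⟨b, hb⟩ := h.exists_ae_norm_x_le (Nat.le_add_left 1 j)
    obtain ⟨b', hb'⟩ := h.exists_ae_norm_x_le (k := j + 1 + 1) (by omega)
    refine ⟨|1 - 1 / β (j + 1)| * b + |1 / β (j + 1)| * b', ?_⟩
    filter_upwards [hb, hb'] with ω h1 h2
    change ‖z (j + 1 + 1) ω‖ ≤ _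
    rw [h.iterates.z_step (j + 1) (Nat.le_add_left 1 j)]
    refine (norm_add_le _ _).trans ?_
    rw [norm_smul, norm_smul, Real.norm_eq_abs, Real.norm_eq_abs]
    gcongr

section

variable [IsProbabilityMeasure P]

lemma measurable_noise (h : BoundedRun P f g R C α β μ ζ x₁ z₁ y₀ β₀ x z y) :
    Measurable fun q : RSpace n × (W × V) => g q.2.1 q.1 - meanInner P g q.1 :=
  (h.data.measurable_inner.comp (measurable_snd.prodMk measurable_fst)).sub
    ((h.data.differentiable_meanInner h.grads).continuous.measurable.comp measurable_fst)

variable [IsProbabilityMeasure μ]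

lemma noise_sq (h : BoundedRun P f g R C α β μ ζ x₁ z₁ y₀ β₀ x z y) {σ : ℝ}
    (hvar : BoundedVariance P g σ) {k : ℕ} (hk : 1 ≤ k) :
    MemLp (fun ω => g (ζ k ω).1 (z k ω) - meanInner P g (z k ω)) 2 μ ∧
      ∫ ω, ‖g (ζ k ω).1 (z k ω) - meanInner P g (z k ω)‖ ^ 2 ∂μ ≤ σ ^ 2 := by
  obtain ⟨j, rfl⟩ := Nat.exists_eq_add_of_le' hk
  have hz := (h.measurable_iterates j).2.1
  have hz' := h.measurable_z hk
  obtain ⟨h1, h2⟩ := integral_le_of_indepFun (P := P)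
    (φ := fun q : RSpace n × (W × V) => ‖g q.2.1 q.1 - meanInner P g q.1‖ ^ 2) hz'
    (h.samples.meas (j + 1)) (h.samples.indepFun_succ hz) (h.samples.law _ hk)
    (h.measurable_noise.norm.pow_const 2) (fun q => by positivity) (fun a => (hvar a).1)
    (fun a => (hvar a).2)
  refine ⟨(memLp_two_iff_integrable_sq_norm ?_).2 h1, h2⟩
  exact (h.measurable_noise.comp (hz'.prodMk (h.samples.meas _))).aestronglyMeasurable

lemma memLp_meanInner_x (h : BoundedRun P f g R C α β μ ζ x₁ z₁ y₀ β₀ x z y) {k : ℕ}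
    (hk : 1 ≤ k) : MemLp (fun ω => meanInner P g (x k ω)) 2 μ := by
  obtain ⟨b, hb⟩ := h.exists_ae_norm_x_le hk
  exact memLp_comp_of_ae_bounded (h.measurable_x hk) hb
    (h.data.differentiable_meanInner h.grads).continuous 2

lemma memLp_meanInner_z (h : BoundedRun P f g R C α β μ ζ x₁ z₁ y₀ β₀ x z y) {k : ℕ}
    (hk : 1 ≤ k) : MemLp (fun ω => meanInner P g (z k ω)) 2 μ := by
  obtain ⟨b, hb⟩ := h.exists_ae_norm_z_le hk
  exact memLp_comp_of_ae_bounded (h.measurable_z hk) hb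
    (h.data.differentiable_meanInner h.grads).continuous 2

lemma memLp_y (h : BoundedRun P f g R C α β μ ζ x₁ z₁ y₀ β₀ x z y) {σ : ℝ}
    (hvar : BoundedVariance P g σ) {k : ℕ} (hk : 1 ≤ k) : MemLp (y k) 2 μ := by
  have hgz : ∀ k, 1 ≤ k → MemLp (fun ω => g (ζ k ω).1 (z k ω)) 2 μ := fun k hk => by
    have := (h.noise_sq hvar hk).1.add (h.memLp_meanInner_z hk)
    refine this.congr_norm ?_ (.of_forall fun ω => by simp)
    exact (h.data.measurable_inner.comp
      ((h.samples.meas k).prodMk (h.measurable_z hk))).aestronglyMeasurable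
  induction k, hk using Nat.le_induction with
  | base =>
    rw [funext h.iterates.y_init]
    have h1 : MemLp (fun _ : Ω => (1 - β₀) • y₀) 2 μ := memLp_const _
    have h2 : MemLp (fun ω => β₀ • g (ζ 1 ω).1 (z 1 ω)) 2 μ := (hgz 1 le_rfl).const_smul β₀
    exact h1.add h2
  | succ k hk ih =>
    rw [funext (h.iterates.y_step k hk)]
    have h1 : MemLp (fun ω => (1 - β k) • y k ω) 2 μ := ih.const_smul (1 - β k)
    have h2 : MemLp (fun ω => β k • g (ζ (k + 1) ω).1 (z (k + 1) ω)) 2 μ :=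
      (hgz (k + 1) (by omega)).const_smul (β k)
    exact h1.add h2

lemma memLp_tracking (h : BoundedRun P f g R C α β μ ζ x₁ z₁ y₀ β₀ x z y) {σ : ℝ}
    (hvar : BoundedVariance P g σ) {k : ℕ} (hk : 1 ≤ k) :
    MemLp (fun ω => y k ω - meanInner P g (x k ω)) 2 μ :=
  (h.memLp_y hvar hk).sub (h.memLp_meanInner_x hk)

/-- Recursion for the mean square error of the tracking variable `y`. -/
lemma tracking_recursion (h : BoundedRun P f g R C α β μ ζ x₁ z₁ y₀ β₀ x z y) {σ Lg : ℝ}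
    (hvar : BoundedVariance P g σ) (hLg : 0 ≤ Lg)
    (hin : ∀ x z, ‖meanInner P g x - meanInner P g z - fderiv ℝ (meanInner P g) z (x - z)‖
      ≤ Lg / 2 * ‖x - z‖ ^ 2) {k : ℕ} (hk : 2 ≤ k) (hβ0 : 0 < β k) (hβ1 : β k ≤ 1) :
    ∫ ω, ‖y (k + 1) ω - meanInner P g (x (k + 1) ω)‖ ^ 2 ∂μ
      ≤ (1 - β k) * ∫ ω, ‖y k ω - meanInner P g (x k ω)‖ ^ 2 ∂μ
        + (Lg / 2 * ((C * C + C) * α k) ^ 2 / β k) ^ 2 / β k + β k ^ 2 * σ ^ 2 := by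
  have hk1 : 1 ≤ k := by omega
  obtain ⟨j, rfl⟩ := Nat.exists_eq_add_of_le' hk1
  have hk2 : 1 ≤ j + 1 + 1 := by omega
  set b := β (j + 1)
  have hgc : Measurable (meanInner P g) :=
    (h.data.differentiable_meanInner h.grads).continuous.measurable
  let e : Ω → RSpace m := fun ω => y (j + 1) ω - meanInner P g (x (j + 1) ω)
  let r : Ω → RSpace m := fun ω =>
    (1 - b) • (meanInner P g (x (j + 1) ω) - meanInner P g (x (j + 1 + 1) ω))
      + b • (meanInner P g (z (j + 1 + 1) ω) - meanInner P g (x (j + 1 + 1) ω))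
  let A : Ω → RSpace m := fun ω => (1 - b) • e ω + r ω
  let ξ : Ω → RSpace m := fun ω =>
    g (ζ (j + 1 + 1) ω).1 (z (j + 1 + 1) ω) - meanInner P g (z (j + 1 + 1) ω)
  have hdecomp : ∀ ω, y (j + 1 + 1) ω - meanInner P g (x (j + 1 + 1) ω) = A ω + b • ξ ω := by
    intro ω
    rw [h.iterates.y_step (j + 1) hk1]
    simp only [A, e, r, ξ, b]
    module
  have hxm := (h.measurable_iterates j).1.mono (samplePast_mono ζ j.le_succ) le_rfl
  have hym := (h.measurable_iterates j).2.2
  obtain ⟨hx2m, hz2m, -⟩ := h.measurable_iterates (j + 1)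
  have hAm : Measurable[samplePast ζ (j + 1)] A := by
    have hxg : Measurable[samplePast ζ (j + 1)] fun ω => meanInner P g (x (j + 1) ω) :=
      hgc.comp hxm
    have hx2g : Measurable[samplePast ζ (j + 1)] fun ω => meanInner P g (x (j + 1 + 1) ω) :=
      hgc.comp hx2m
    have hz2g : Measurable[samplePast ζ (j + 1)] fun ω => meanInner P g (z (j + 1 + 1) ω) :=
      hgc.comp hz2m
    have h1 : Measurable[samplePast ζ (j + 1)] fun ω => (1 - b) • e ω :=
      (hym.sub hxg).const_smul (1 - b)
    have h2 : Measurable[samplePast ζ (j + 1)] r :=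
      ((hxg.sub hx2g).const_smul (1 - b)).add ((hz2g.sub hx2g).const_smul b)
    exact h1.add h2
  have hrL : MemLp r 2 μ :=
    (((h.memLp_meanInner_x hk1).sub (h.memLp_meanInner_x hk2)).const_smul (1 - b)).add
      (((h.memLp_meanInner_z hk2).sub (h.memLp_meanInner_x hk2)).const_smul b)
  have heL : MemLp e 2 μ := h.memLp_tracking hvar hk1
  have hAL : MemLp A 2 μ := (heL.const_smul (1 - b)).add hrL
  obtain ⟨hξL, hξσ⟩ := h.noise_sq hvar hk2
  change MemLp ξ 2 μ at hξL
  change ∫ ω, ‖ξ ω‖ ^ 2 ∂μ ≤ σ ^ 2 at hξσ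
  have hAξ : Integrable (fun ω => inner ℝ (A ω) (ξ ω)) μ := hAL.integrable_inner_of_two hξL
  -- A and z_{k+1} are functions of the past samples, and z_{k+1} is carried along because the noise
  -- of the fresh sample is evaluated there.
  have hcross : ∫ ω, inner ℝ (A ω) (ξ ω) ∂μ = 0 := by
    have hφ : Measurable fun q : (RSpace m × RSpace n) × (W × V) =>
        (inner ℝ q.1.1 (g q.2.1 q.1.2 - meanInner P g q.1.2) : ℝ) :=
      (measurable_fst.comp measurable_fst).inner
        (h.measurable_noise.comp ((measurable_snd.comp measurable_fst).prodMk measurable_snd))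
    refine integral_eq_zero_of_indepFun (P := P) (X := fun ω => (A ω, z (j + 1 + 1) ω))
      ((hAm.prodMk hz2m).mono (h.samples.samplePast_le _) le_rfl) (h.samples.meas (j + 1 + 1))
      (h.samples.indepFun_succ (hAm.prodMk hz2m)) (h.samples.law _ hk2) hφ hAξ fun a => ?_
    have hi := h.data.g_int a.2
    have := integral_inner (𝕜 := ℝ) (hi.sub (integrable_const (meanInner P g a.2))) a.1
    simp only [Pi.sub_apply] at this
    rw [this, integral_sub hi (integrable_const _)]
    simp [meanInner]
  have hAsq := hAL.integrable_norm_pow two_ne_zero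
  have hξsq := hξL.integrable_norm_pow two_ne_zero
  have hesq := heL.integrable_norm_pow two_ne_zero
  simp only [hdecomp]
  have hexp : ∀ ω, ‖A ω + b • ξ ω‖ ^ 2
      = ‖A ω‖ ^ 2 + 2 * b * inner ℝ (A ω) (ξ ω) + b ^ 2 * ‖ξ ω‖ ^ 2 := fun ω => by
    rw [norm_add_sq_real, norm_smul, inner_smul_right, mul_pow, Real.norm_eq_abs, sq_abs]
    ring
  have hsum : ∫ ω, ‖A ω + b • ξ ω‖ ^ 2 ∂μ
      = ∫ ω, ‖A ω‖ ^ 2 ∂μ + b ^ 2 * ∫ ω, ‖ξ ω‖ ^ 2 ∂μ := by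
    simp only [hexp]
    have hAξ' := hAξ.const_mul (2 * b)
    have hsum' : Integrable (fun ω => ‖A ω‖ ^ 2 + 2 * b * inner ℝ (A ω) (ξ ω)) μ := hAsq.add hAξ'
    rw [integral_add hsum' (hξsq.const_mul _), integral_add hAsq hAξ', integral_const_mul, integral_const_mul, hcross, mul_zero,
      add_zero]
  set D := (Lg / 2 * ((C * C + C) * α (j + 1)) ^ 2 / b) ^ 2 / b
  have hAle : ∫ ω, ‖A ω‖ ^ 2 ∂μ ≤ (1 - b) * ∫ ω, ‖e ω‖ ^ 2 ∂μ + D := by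
    have : ∫ ω, ((1 - b) * ‖e ω‖ ^ 2 + D) ∂μ = (1 - b) * ∫ ω, ‖e ω‖ ^ 2 ∂μ + D := by
      rw [integral_add (hesq.const_mul _) (integrable_const _), integral_const_mul]
      simp
    rw [← this]
    refine integral_mono_ae hAsq ((hesq.const_mul _).add (integrable_const _)) ?_
    filter_upwards [h.ae_norm_step_le] with ω hω
    refine (norm_convex_combo_add_sq_le hβ0 hβ1 (e ω) (r ω)).trans ?_
    have h1 := norm_extrapolation_error_le hLg hin hβ0 hβ1 (h.iterates.z_step (j + 1) hk1 ω)
    have h2 := hω (j + 1) hk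
    have h3 : ‖r ω‖ ≤ Lg / 2 * ((C * C + C) * α (j + 1)) ^ 2 / b := by
      refine h1.trans ?_
      gcongr
    simp only [D]
    gcongr
  rw [hsum]
  have := mul_le_mul_of_nonneg_left hξσ (sq_nonneg b)
  linarith

end

end BoundedRun

end Algorithm

/-! ### Gradient noise and the recursion for the distance. -/

section Algorithm

variable {W V Ω : Type*} [MeasurableSpace W] [MeasurableSpace V] [MeasurableSpace Ω] {n m : ℕ}

variable {P : Measure (W × V)} {f : V → RSpace m → ℝ} {g : W → RSpace n → RSpace m}
  {R : RSpace n → EReal} {C : ℝ} {α β : ℕ → ℝ} {μ : Measure Ω} {ζ : ℕ → Ω → W × V}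
  {x₁ z₁ : RSpace n} {y₀ : RSpace m} {β₀ : ℝ}
  {x z : ℕ → Ω → RSpace n} {y : ℕ → Ω → RSpace m}

namespace BoundedRun

variable [IsProbabilityMeasure P] [IsProbabilityMeasure μ]

lemma _root_.ProblemData.measurable_exactGradient (h : ProblemData P f g R)
    (hb : BoundedGradients P f g R C) : Measurable fun q : RSpace n × (W × V) =>
      compGrad (g q.2.1) (f q.2.2) q.1 (meanInner P g q.1) := by
  have h1 : Measurable fun q : RSpace n × (W × V) => meanInner P g q.1 :=
    (h.differentiable_meanInner hb).continuous.measurable.comp measurable_fst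
  have h2 : Measurable fun q : RSpace n × (W × V) => (q.2, q.1, meanInner P g q.1) :=
    measurable_snd.prodMk (measurable_fst.prodMk h1)
  have := h.measurable_compGrad.comp h2
  exact this

lemma _root_.ProblemData.exactGradient_unbiased (h : ProblemData P f g R)
    (hb : BoundedGradients P f g R C) (hunb : UnbiasedOracle P f g) (u : RSpace n) :
    Integrable (fun q : W × V => compGrad (g q.1) (f q.2) u (meanInner P g u)) P ∧
      ∫ q, compGrad (g q.1) (f q.2) u (meanInner P g u) ∂P = gradient (smoothPart P f g) u ∧
      ‖gradient (smoothPart P f g) u‖ ≤ C * C := by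
  have h1 : ∀ᵐ q ∂P, ‖compGrad (g q.1) (f q.2) u (meanInner P g u)‖ ≤ C * C := by
    filter_upwards [hb.inner, hb.outer] with q h1 h2
    exact norm_compGrad_le (h1 _) (h2 _)
  have h2 : Measurable fun q : W × V => compGrad (g q.1) (f q.2) u (meanInner P g u) := by
    have := (h.measurable_exactGradient hb).comp (measurable_const (a := u).prodMk measurable_id)
    exact this
  have h3 : ∫ q, compGrad (g q.1) (f q.2) u (meanInner P g u) ∂P
      = gradient (smoothPart P f g) u := by
    rw [hunb.grad, h.gradient_smoothPart hb]
  refine ⟨Integrable.of_bound h2.aestronglyMeasurable _ h1, h3, ?_⟩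
  rw [← h3]
  refine (norm_integral_le_of_norm_le_const h1).trans_eq ?_
  rw [probReal_univ, mul_one]

/-- With the inner argument g(x_k) in place of y_k, the sampled gradient depends only on x_k and the
independent sample of index k, so unbiasedness applies. -/
lemma gradient_noise (h : BoundedRun P f g R C α β μ ζ x₁ z₁ y₀ β₀ x z y)
    (hunb : UnbiasedOracle P f g) {φ : RSpace n → RSpace n} (hφ : Continuous φ) {k : ℕ}
    (hk : 1 ≤ k) :
    Integrable (fun ω => (inner ℝ
      (compGrad (g (ζ k ω).1) (f (ζ k ω).2) (x k ω) (meanInner P g (x k ω))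
        - gradient (smoothPart P f g) (x k ω)) (φ (x k ω)) : ℝ)) μ ∧
    ∫ ω, inner ℝ
      (compGrad (g (ζ k ω).1) (f (ζ k ω).2) (x k ω) (meanInner P g (x k ω))
        - gradient (smoothPart P f g) (x k ω)) (φ (x k ω)) ∂μ = 0 := by
  have hun := fun u => h.data.exactGradient_unbiased h.grads hunb u
  have hNm : Measurable fun q : RSpace n × (W × V) =>
      compGrad (g q.2.1) (f q.2.2) q.1 (meanInner P g q.1) - gradient (smoothPart P f g) q.1 := by
    have h1 : Measurable fun q : RSpace n × (W × V) => gradient (smoothPart P f g) q.1 :=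
      (ProblemData.measurable_gradient_smoothPart P f g).comp measurable_fst
    exact (h.data.measurable_exactGradient h.grads).sub h1
  have hψ : Measurable fun q : RSpace n × (W × V) => (inner ℝ
      (compGrad (g q.2.1) (f q.2.2) q.1 (meanInner P g q.1) - gradient (smoothPart P f g) q.1)
      (φ q.1) : ℝ) :=
    hNm.inner (hφ.measurable.comp measurable_fst)
  have hNω : Measurable fun ω => compGrad (g (ζ k ω).1) (f (ζ k ω).2) (x k ω)
      (meanInner P g (x k ω)) - gradient (smoothPart P f g) (x k ω) := by
    have := hNm.comp ((h.measurable_x hk).prodMk (h.samples.meas k))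
    exact this
  have hNL : MemLp (fun ω => compGrad (g (ζ k ω).1) (f (ζ k ω).2) (x k ω) (meanInner P g (x k ω))
      - gradient (smoothPart P f g) (x k ω)) 2 μ := by
    refine MemLp.of_bound hNω.aestronglyMeasurable (C * C + C * C) ?_
    filter_upwards [h.ae_norm_compGrad_le] with ω hω
    exact (norm_sub_le _ _).trans (add_le_add (hω k hk _ _) (hun _).2.2)
  obtain ⟨b, hb⟩ := h.exists_ae_norm_x_le hk
  have hψi := hNL.integrable_inner_of_two (memLp_comp_of_ae_bounded (h.measurable_x hk) hb hφ 2)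
  refine ⟨hψi, ?_⟩
  obtain ⟨j, rfl⟩ := Nat.exists_eq_add_of_le' hk
  have hxm := (h.measurable_iterates j).1
  refine integral_eq_zero_of_indepFun (P := P) (h.measurable_x hk) (h.samples.meas (j + 1))
    (h.samples.indepFun_succ hxm) (h.samples.law _ hk) hψ hψi fun a => ?_
  have h1 := integral_inner (𝕜 := ℝ)
    ((hun a).1.sub (integrable_const (gradient (smoothPart P f g) a))) (φ a)
  simp only [Pi.sub_apply] at h1
  simp_rw [real_inner_comm (φ a)]
  rw [h1, integral_sub (hun a).1 (integrable_const _), (hun a).2.1]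
  simp

/-- Recursion for the mean square distance to the set of minimizers. -/
lemma distance_recursion (h : BoundedRun P f g R C α β μ ζ x₁ z₁ y₀ β₀ x z y) {σ lam Lf δ : ℝ}
    (hvar : BoundedVariance P g σ) (hunb : UnbiasedOracle P f g)
    (hconv : ConvexOn ℝ Set.univ (smoothPart P f g))
    (hsol : (optimalSet (objective P f g R)).Nonempty)
    (hosc : OptimallyStronglyConvex (objective P f g R) lam)
    (hLf : ∀ᵐ p ∂P, ∀ y u, ‖gradient (f p.2) y - gradient (f p.2) u‖ ≤ Lf * ‖y - u‖)
    (hδ : 0 < δ) {k : ℕ} (hk : 2 ≤ k) :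
    ∫ ω, ‖x (k + 1) ω - euclProj (optimalSet (objective P f g R)) (x (k + 1) ω)‖ ^ 2 ∂μ
      ≤ (1 - (2 * lam - δ) * α k)
          * ∫ ω, ‖x k ω - euclProj (optimalSet (objective P f g R)) (x k ω)‖ ^ 2 ∂μ
        + α k * ((C * Lf) ^ 2 / δ) * ∫ ω, ‖y k ω - meanInner P g (x k ω)‖ ^ 2 ∂μ
        + 2 * (C * C + C) ^ 2 * α k ^ 2 := by
  have hk1 : 1 ≤ k := by omega
  have hFd := h.data.differentiable_smoothPart h.grads
  have hcl : IsClosed (optimalSet (objective P f g R)) :=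
    isClosed_optimalSet h.data.R_closedConvex hFd.continuous
  have hcv : Convex ℝ (optimalSet (objective P f g R)) :=
    convex_optimalSet h.data.R_closedConvex hconv
  set S := optimalSet (objective P f g R)
  have hφ : Continuous fun u : RSpace n => u - euclProj S u :=
    continuous_id.sub (continuous_euclProj hsol hcl hcv)
  have hd : ∀ k, 1 ≤ k → MemLp (fun ω => x k ω - euclProj S (x k ω)) 2 μ := fun k hk => by
    obtain ⟨b, hb⟩ := h.exists_ae_norm_x_le hk
    exact memLp_comp_of_ae_bounded (h.measurable_x hk) hb hφ 2
  obtain ⟨hψi, hψ0⟩ := h.gradient_noise hunb hφ hk1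
  have hdsq := (hd k hk1).integrable_norm_pow two_ne_zero
  have hdsq' := (hd (k + 1) (by omega)).integrable_norm_pow two_ne_zero
  have hesq := (h.memLp_tracking hvar hk1).integrable_norm_pow two_ne_zero
  set a := α k
  have ha : 0 < a := h.step_pos k hk1
  have hpt : ∀ᵐ ω ∂μ, ‖x (k + 1) ω - euclProj S (x (k + 1) ω)‖ ^ 2
      ≤ (1 - (2 * lam - δ) * a) * ‖x k ω - euclProj S (x k ω)‖ ^ 2
        + a * ((C * Lf) ^ 2 / δ) * ‖y k ω - meanInner P g (x k ω)‖ ^ 2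
        + 2 * (C * C + C) ^ 2 * a ^ 2 - 2 * a * inner ℝ
          (compGrad (g (ζ k ω).1) (f (ζ k ω).2) (x k ω) (meanInner P g (x k ω))
            - gradient (smoothPart P f g) (x k ω)) (x k ω - euclProj S (x k ω)) := by
    filter_upwards [h.ae_norm_compGrad_le, h.samples.ae_sample h.grads.inner,
      h.samples.ae_sample hLf] with ω h1 h2 h3
    obtain ⟨s, hs, hsC⟩ := h.grads.penalty _ (h.ne_top hk ω)
    have h4 := sq_dist_prox_step_le h.data.R_closedConvex hconv hFd hsol hosc ha hs hsC
      (h1 k hk1 (x k ω) (y k ω)) (h.iterates.x_step k hk1 ω)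
    change ‖x (k + 1) ω - euclProj S (x (k + 1) ω)‖ ^ 2
      ≤ (1 - 2 * lam * a) * ‖x k ω - euclProj S (x k ω)‖ ^ 2 - 2 * a * inner ℝ _
        (x k ω - euclProj S (x k ω)) + _ at h4
    refine h4.trans ?_
    have h5 := norm_compGrad_sub_le (x := x k ω) (y := y k ω) (u := meanInner P g (x k ω))
      (h2 k hk1 _) (h3 k hk1 _ _)
    set p := x k ω - euclProj S (x k ω)
    set G := compGrad (g (ζ k ω).1) (f (ζ k ω).2) (x k ω) (y k ω)
    set G₀ := compGrad (g (ζ k ω).1) (f (ζ k ω).2) (x k ω) (meanInner P g (x k ω))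
    set ε := ‖y k ω - meanInner P g (x k ω)‖
    -- The estimate y_k contains w_k, so G itself need not be conditionally unbiased. G₀ isolates
    -- the centred part, and G - G₀ is controlled by the tracking error.
    have e1 : G - gradient (smoothPart P f g) (x k ω)
        = (G₀ - gradient (smoothPart P f g) (x k ω)) + (G - G₀) := by abel
    rw [e1, inner_add_left]
    have h6 : -inner ℝ (G - G₀) p ≤ C * Lf * ε * ‖p‖ := by
      rw [← inner_neg_left]
      refine (real_inner_le_norm _ _).trans ?_
      rw [norm_neg]
      gcongr
    -- Young's inequality, giving up δ of the contraction 2λ.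
    have h7 : 2 * (C * Lf * ε * ‖p‖) ≤ δ * ‖p‖ ^ 2 + (C * Lf) ^ 2 / δ * ε ^ 2 := by
      have : 0 ≤ (δ * ‖p‖ - C * Lf * ε) ^ 2 / δ := by positivity
      have e2 : (δ * ‖p‖ - C * Lf * ε) ^ 2 / δ
          = δ * ‖p‖ ^ 2 - 2 * (C * Lf * ε * ‖p‖) + (C * Lf) ^ 2 / δ * ε ^ 2 := by
        field_simp; ring
      linarith
    have h8 := mul_le_mul_of_nonneg_left (h7.trans' (mul_le_mul_of_nonneg_left h6 two_pos.le)) ha.le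
    linarith
  have hi1 := hdsq.const_mul (1 - (2 * lam - δ) * a)
  have hi2 := hesq.const_mul (a * ((C * Lf) ^ 2 / δ))
  have hi3 : Integrable (fun ω => (1 - (2 * lam - δ) * a) * ‖x k ω - euclProj S (x k ω)‖ ^ 2
    + a * ((C * Lf) ^ 2 / δ) * ‖y k ω - meanInner P g (x k ω)‖ ^ 2) μ := hi1.add hi2
  have hi4 : Integrable (fun ω => (1 - (2 * lam - δ) * a) * ‖x k ω - euclProj S (x k ω)‖ ^ 2
    + a * ((C * Lf) ^ 2 / δ) * ‖y k ω - meanInner P g (x k ω)‖ ^ 2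
    + 2 * (C * C + C) ^ 2 * a ^ 2) μ := hi3.add (integrable_const _)
  have hi5 := hψi.const_mul (2 * a)
  refine (integral_mono_ae hdsq' (hi4.sub hi5) hpt).trans_eq ?_
  simp only [Pi.sub_apply]
  rw [integral_sub hi4 hi5, integral_add hi3 (integrable_const _), integral_add hi1 hi2,
    integral_const_mul, integral_const_mul, integral_const_mul (2 * a), hψ0]
  simp

lemma integrable_sq_dist (h : BoundedRun P f g R C α β μ ζ x₁ z₁ y₀ β₀ x z y)
    (hconv : ConvexOn ℝ Set.univ (smoothPart P f g))
    (hsol : (optimalSet (objective P f g R)).Nonempty) {k : ℕ} (hk : 1 ≤ k) :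
    Integrable (fun ω => ‖x k ω - euclProj (optimalSet (objective P f g R)) (x k ω)‖ ^ 2) μ := by
  have hcl : IsClosed (optimalSet (objective P f g R)) :=
    isClosed_optimalSet h.data.R_closedConvex
      (h.data.differentiable_smoothPart h.grads).continuous
  have hcv : Convex ℝ (optimalSet (objective P f g R)) :=
    convex_optimalSet h.data.R_closedConvex hconv
  obtain ⟨b, hb⟩ := h.exists_ae_norm_x_le hk
  exact memLp_one_iff_integrable.1 (memLp_comp_of_ae_bounded (h.measurable_x hk) hb
    ((continuous_id.sub (continuous_euclProj hsol hcl hcv)).norm.pow 2) 1)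

end BoundedRun

end Algorithm

lemma MeanSqDistBigO.mono {Ω : Type*} [MeasurableSpace Ω] {μ : Measure Ω} {n : ℕ}
    {x : ℕ → Ω → RSpace n} {S : Set (RSpace n)} {r r' : ℕ → ℝ}
    (h : MeanSqDistBigO μ x S r) {D : ℝ} (hD : 0 < D) (hr : ∀ k ≥ 1, r k ≤ D * r' k) :
    MeanSqDistBigO μ x S r' := by
  obtain ⟨c, hc, hck⟩ := h
  refine ⟨c * D, by positivity, fun k hk => ⟨(hck k hk).1, (hck k hk).2.trans ?_⟩⟩
  rw [mul_assoc]
  exact mul_le_mul_of_nonneg_left (hr k hk) hc.le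

/-! ### Solving the two recursions. -/

section Rate

open Filter

variable {W V Ω : Type*} [MeasurableSpace W] [MeasurableSpace V] [MeasurableSpace Ω] {n m : ℕ}
  {P : Measure (W × V)} {f : V → RSpace m → ℝ} {g : W → RSpace n → RSpace m}
  {R : RSpace n → EReal} {C : ℝ} {μ : Measure Ω} {ζ : ℕ → Ω → W × V}
  {x₁ z₁ : RSpace n} {y₀ : RSpace m} {β₀ : ℝ}
  {x z : ℕ → Ω → RSpace n} {y : ℕ → Ω → RSpace m} [IsProbabilityMeasure P] [IsProbabilityMeasure μ]
  {a b Ca Cb : ℝ}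

/-- Rate of the mean square tracking error. -/
lemma BoundedRun.tracking_rate
    (h : BoundedRun P f g R C (fun k => Ca * (k : ℝ) ^ (-a)) (fun k => Cb * (k : ℝ) ^ (-b))
      μ ζ x₁ z₁ y₀ β₀ x z y) {σ Lg : ℝ} (hvar : BoundedVariance P g σ) (hLg : 0 ≤ Lg)
    (hin : ∀ x z, ‖meanInner P g x - meanInner P g z - fderiv ℝ (meanInner P g) z (x - z)‖
      ≤ Lg / 2 * ‖x - z‖ ^ 2) (ha1 : a ≤ 1) (hb0 : 0 < b) (hb1 : b ≤ 1) (hCb : 2 < Cb) :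
    ∃ c : ℝ, 0 < c ∧ ∀ k ≥ 1, ∫ ω, ‖y k ω - meanInner P g (x k ω)‖ ^ 2 ∂μ
      ≤ c * (Lg * (k : ℝ) ^ (-(4 * a - 4 * b)) + (k : ℝ) ^ (-b)) := by
  have hCb0 : 0 < Cb := by linarith
  -- With θ = 1/2, the term k^{-b} at b = 1 needs 1 ≤ C_b/2, which C_b > 2 provides. One factor of
  -- L_g² from the source goes into A, the other stays in r.
  refine exists_rate_bound (u := fun k => ∫ ω, ‖y k ω - meanInner P g (x k ω)‖ ^ 2 ∂μ)
    (r := fun k => Lg * (k : ℝ) ^ (-(4 * a - 4 * b)) + (k : ℝ) ^ (-b)) (θ := 1 / 2) (B := Cb)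
    (A := Lg / 4 * (C * C + C) ^ 4 * (Ca / Cb) ^ 4 + σ ^ 2 * Cb) (q := b)
    (by norm_num) hCb0 hb0 (fun k hk => ?_) ?_ ?_
  · have hk0 : (0 : ℝ) < k := by exact_mod_cast hk
    positivity
  · filter_upwards [eventually_rpow_decay (s := 4 * a - 4 * b) (q := b) (D := 1 / 2 * Cb)
      (by positivity) hb1 (fun hb => by linarith),
      eventually_rpow_decay (s := b) (q := b) (D := 1 / 2 * Cb)
      (by positivity) hb1 (fun hb => by linarith)] with k h1 h2
    have h3 := mul_le_mul_of_nonneg_left h1 hLg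
    simp only [← mul_assoc] at h1 h2 h3 ⊢
    nlinarith
  · have hlim : Tendsto (fun k : ℕ => Cb * (k : ℝ) ^ (-b)) atTop (nhds 0) := by
      simpa using (tendsto_natCast_rpow_neg hb0).const_mul Cb
    filter_upwards [hlim.eventually_le_const one_pos, eventually_ge_atTop 2] with k hβ1 hk
    have hk0 : (0 : ℝ) < k := by exact_mod_cast (by omega : 0 < k)
    have hβ0 : 0 < Cb * (k : ℝ) ^ (-b) := by positivity
    refine (h.tracking_recursion hvar hLg hin hk hβ0 hβ1).trans ?_
    have hpow : (k : ℝ) ^ (-(4 * a - 4 * b)) = ((k : ℝ) ^ (-a)) ^ 4 / ((k : ℝ) ^ (-b)) ^ 4 := by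
      rw [← Real.rpow_natCast, ← Real.rpow_natCast, ← Real.rpow_mul hk0.le, ← Real.rpow_mul hk0.le,
        ← Real.rpow_sub hk0]
      congr 1
      push_cast
      ring
    simp only [hpow]
    set s := (k : ℝ) ^ (-a)
    have ht0 : 0 < (k : ℝ) ^ (-b) := by positivity
    set t := (k : ℝ) ^ (-b)
    have e1 : (Lg / 2 * ((C * C + C) * (Ca * s)) ^ 2 / (Cb * t)) ^ 2 / (Cb * t)
        = (Lg / 4 * (C * C + C) ^ 4 * (Ca / Cb) ^ 4) * (Cb * t) * (Lg * (s ^ 4 / t ^ 4)) := by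
      field_simp
      ring
    have e2 : (Cb * t) ^ 2 * σ ^ 2 = (σ ^ 2 * Cb) * (Cb * t) * t := by ring
    rw [e1, e2]
    have h1 : 0 ≤ (Lg / 4 * (C * C + C) ^ 4 * (Ca / Cb) ^ 4) * (Cb * t) * t := by positivity
    have h2 : 0 ≤ (σ ^ 2 * Cb) * (Cb * t) * (Lg * (s ^ 4 / t ^ 4)) := by positivity
    linarith

/-- For a = 1, δ makes (2λ-δ)C_a the midpoint of 1 and 2λC_a, and θ is its reciprocal. -/
lemma exists_contraction_params {lam : ℝ} (hlam : 0 < lam) (hCa : 0 < Ca)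
    (hCa1 : a = 1 → 1 < 2 * lam * Ca) :
    ∃ δ θ : ℝ, 0 < δ ∧ δ < 2 * lam ∧ 0 < θ ∧ θ < 1 ∧ (a = 1 → 1 ≤ θ * ((2 * lam - δ) * Ca)) := by
  by_cases ha : a = 1
  · have h1 := hCa1 ha
    refine ⟨(2 * lam * Ca - 1) / (2 * Ca), 2 / (2 * lam * Ca + 1), div_pos (by linarith)
      (by linarith), ?_, by positivity, ?_, fun _ => ?_⟩
    · rw [div_lt_iff₀ (by linarith)]; nlinarith
    · rw [div_lt_one (by positivity)]; linarith
    · have : 2 / (2 * lam * Ca + 1) * ((2 * lam - (2 * lam * Ca - 1) / (2 * Ca)) * Ca) = 1 := by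
        field_simp; ring
      exact this.ge
  · exact ⟨lam, 1 / 2, hlam, by linarith, by norm_num, by norm_num, fun h => absurd h ha⟩

/-- Rate of the mean square distance to the set of minimizers. -/
lemma BoundedRun.distance_rate
    (h : BoundedRun P f g R C (fun k => Ca * (k : ℝ) ^ (-a)) (fun k => Cb * (k : ℝ) ^ (-b))
      μ ζ x₁ z₁ y₀ β₀ x z y) {σ lam Lf Lg : ℝ} (hvar : BoundedVariance P g σ)
    (hunb : UnbiasedOracle P f g) (hconv : ConvexOn ℝ Set.univ (smoothPart P f g))
    (hsol : (optimalSet (objective P f g R)).Nonempty) (hlam : 0 < lam)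
    (hosc : OptimallyStronglyConvex (objective P f g R) lam)
    (hLf : ∀ᵐ p ∂P, ∀ y u, ‖gradient (f p.2) y - gradient (f p.2) u‖ ≤ Lf * ‖y - u‖)
    (hLg : 0 ≤ Lg)
    (hin : ∀ x z, ‖meanInner P g x - meanInner P g z - fderiv ℝ (meanInner P g) z (x - z)‖
      ≤ Lg / 2 * ‖x - z‖ ^ 2) (ha0 : 0 < a) (ha1 : a ≤ 1) (hb0 : 0 < b) (hb1 : b ≤ 1)
    (hCa : 0 < Ca) (hCa1 : a = 1 → 1 < 2 * lam * Ca) (hCb : 2 < Cb) :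
    ∃ c : ℝ, 0 < c ∧ ∀ k ≥ 1,
      ∫ ω, ‖x k ω - euclProj (optimalSet (objective P f g R)) (x k ω)‖ ^ 2 ∂μ
        ≤ c * ((k : ℝ) ^ (-a) + Lf ^ 2 * Lg * (k : ℝ) ^ (-4 * a + 4 * b)
          + Lf ^ 2 * (k : ℝ) ^ (-b)) := by
  obtain ⟨cy, hcy0, hcy⟩ := h.tracking_rate hvar hLg hin ha1 hb0 hb1 hCb
  obtain ⟨δ, θ, hδ0, hδ2, hθ0, hθ1, hθ⟩ := exists_contraction_params hlam hCa hCa1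
  have hB : 0 < (2 * lam - δ) * Ca := mul_pos (by linarith) hCa
  have hD : 0 < θ * ((2 * lam - δ) * Ca) := mul_pos hθ0 hB
  set B := (2 * lam - δ) * Ca with hBdef
  -- The decay of `r` must not be faster than that of `k ^ (-a)`.
  obtain ⟨c, hc0, hc⟩ := exists_rate_bound
    (u := fun k => ∫ ω, ‖x k ω - euclProj (optimalSet (objective P f g R)) (x k ω)‖ ^ 2 ∂μ)
    (r := fun k => (k : ℝ) ^ (-a) + Lf ^ 2 * Lg * (k : ℝ) ^ (-min a (4 * a - 4 * b))
          + Lf ^ 2 * (k : ℝ) ^ (-b)) (θ := θ) (B := B)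
    (A := Ca / B * (C ^ 2 / δ * cy + 2 * (C * C + C) ^ 2 * Ca)) (q := a)
    hθ1 hB ha0 (fun k hk => by
      have hk0 : (0 : ℝ) < k := by exact_mod_cast hk
      positivity)
    (by
      filter_upwards [eventually_rpow_decay (s := a) (q := a) hD ha1 (fun ha => by linarith [hθ ha]),
        eventually_rpow_decay (s := min a (4 * a - 4 * b)) (q := a) hD ha1
          (fun ha => (min_le_left _ _).trans (by linarith [hθ ha])),
        eventually_rpow_decay (s := b) (q := a) hD ha1 (fun ha => by linarith [hθ ha])]
        with k h1 h2 h3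
      have h4 := mul_le_mul_of_nonneg_left h2 (by positivity : 0 ≤ Lf ^ 2 * Lg)
      have h5 := mul_le_mul_of_nonneg_left h3 (by positivity : 0 ≤ Lf ^ 2)
      simp only [← mul_assoc] at h1 h4 h5 ⊢
      nlinarith)
    (by
      filter_upwards [eventually_ge_atTop 2] with k hk
      have hk1 : 1 ≤ k := by omega
      have hk0 : (1 : ℝ) ≤ k := by exact_mod_cast hk1
      refine (h.distance_recursion hvar hunb hconv hsol hosc hLf hδ0 hk).trans ?_
      have h1 := hcy k hk1
      have h2 : (k : ℝ) ^ (-(4 * a - 4 * b)) ≤ (k : ℝ) ^ (-min a (4 * a - 4 * b)) :=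
        Real.rpow_le_rpow_of_exponent_le hk0 (neg_le_neg (min_le_right _ _))
      have hs0 : 0 < (k : ℝ) ^ (-a) := by positivity
      have ht0 : 0 < (k : ℝ) ^ (-b) := by positivity
      have hv0 : 0 < (k : ℝ) ^ (-min a (4 * a - 4 * b)) := by positivity
      set s := (k : ℝ) ^ (-a)
      set t := (k : ℝ) ^ (-b)
      set v := (k : ℝ) ^ (-min a (4 * a - 4 * b))
      have h3 : ∫ ω, ‖y k ω - meanInner P g (x k ω)‖ ^ 2 ∂μ ≤ cy * (Lg * v + t) :=
        h1.trans (by gcongr)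
      have h4 : Ca * s * ((C * Lf) ^ 2 / δ) * ∫ ω, ‖y k ω - meanInner P g (x k ω)‖ ^ 2 ∂μ
          ≤ Ca * s * ((C * Lf) ^ 2 / δ) * (cy * (Lg * v + t)) :=
        mul_le_mul_of_nonneg_left h3 (by positivity)
      have e1 : Ca / B * (C ^ 2 / δ * cy + 2 * (C * C + C) ^ 2 * Ca) * (B * s)
          = Ca * (C ^ 2 / δ * cy + 2 * (C * C + C) ^ 2 * Ca) * s := by
        field_simp
      have e2 : Ca * s * ((C * Lf) ^ 2 / δ) * (cy * (Lg * v + t))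
          = Ca * (C ^ 2 / δ * cy) * s * (Lf ^ 2 * Lg * v + Lf ^ 2 * t) := by ring
      have h5 : 0 ≤ Ca * (C ^ 2 / δ * cy) * s * s := by positivity
      have h6 : 0 ≤ Ca * (2 * (C * C + C) ^ 2 * Ca) * s * (Lf ^ 2 * Lg * v + Lf ^ 2 * t) := by
        positivity
      rw [e1]
      rw [e2] at h4
      have e3 : (2 * lam - δ) * (Ca * s) = B * s := by rw [hBdef]; ring
      rw [e3]
      linarith)
  -- Undoing the minimum in the exponent adds a term L_f² L_g k^{-a}, which the enlarged constant
  -- absorbs into k^{-a}.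
  refine ⟨c * (1 + Lf ^ 2 * Lg), by positivity, fun k hk => (hc k hk).trans ?_⟩
  rw [mul_assoc c]
  refine mul_le_mul_of_nonneg_left ?_ hc0.le
  have h1 := mul_le_mul_of_nonneg_left (rpow_neg_min_le a (4 * a - 4 * b) hk)
    (by positivity : 0 ≤ Lf ^ 2 * Lg)
  rw [show -4 * a + 4 * b = -(4 * a - 4 * b) by ring]
  have h2 : 0 ≤ Lf ^ 2 * Lg * (Lf ^ 2 * Lg * (k : ℝ) ^ (-(4 * a - 4 * b)) + Lf ^ 2 * (k : ℝ) ^ (-b)) := by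
    positivity
  linarith

end Rate

theorem theorem2 {W V Ω : Type*} [MeasurableSpace W] [MeasurableSpace V] [MeasurableSpace Ω]
    {n m : ℕ}
    (P : Measure (W × V)) [IsProbabilityMeasure P]
    (f : V → RSpace m → ℝ) (g : W → RSpace n → RSpace m) (R : RSpace n → EReal)
    (hdata : ProblemData P f g R)
    (hsol : (optimalSet (objective P f g R)).Nonempty)
    (hconv : ConvexOn ℝ Set.univ (smoothPart P f g))
    (lam : ℝ) (hlam : 0 < lam)
    (hosc : OptimallyStronglyConvex (objective P f g R) lam)
    (hunb : UnbiasedOracle P f g)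
    (σ : ℝ) (hvar : BoundedVariance P g σ)
    (C : ℝ) (hgrad : BoundedGradients P f g R C)
    (LF Lf Lg : ℝ) (hsmooth : SmoothnessConditions P f g LF Lf Lg)
    (a b Ca Cb : ℝ) (ha0 : 0 < a) (ha1 : a ≤ 1) (hb0 : 0 < b) (hb1 : b ≤ 1)
    (hCa : 0 < Ca) (hCa1 : a = 1 → 1 < 2 * lam * Ca) (hCb : 2 < Cb)
    (μ : Measure Ω) [IsProbabilityMeasure μ]
    (ζ : ℕ → Ω → W × V) (hζ : OracleSamples μ P ζ)
    (x₁ z₁ : RSpace n) (y₀ : RSpace m) (β₀ : ℝ)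
    (x z : ℕ → Ω → RSpace n) (y : ℕ → Ω → RSpace m)
    (halg : IsASCPG f g R (fun k => Ca * (k : ℝ) ^ (-a)) (fun k => Cb * (k : ℝ) ^ (-b)) ζ
      x₁ z₁ y₀ β₀ x z y) :
    MeanSqDistBigO μ x (optimalSet (objective P f g R))
      (fun k => (k : ℝ) ^ (-a) + Lf ^ 2 * Lg * (k : ℝ) ^ (-4 * a + 4 * b)
        + Lf ^ 2 * (k : ℝ) ^ (-b)) ∧
    (a = 1 → b = 4 / 5 →
      MeanSqDistBigO μ x (optimalSet (objective P f g R)) (fun k => (k : ℝ) ^ (-(4 / 5 : ℝ)))) ∧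
    (Lg = 0 ∨ Lf = 0 → a = 1 → b = 1 →
      MeanSqDistBigO μ x (optimalSet (objective P f g R)) (fun k => (k : ℝ) ^ (-1 : ℝ))) := by
  have hrun : BoundedRun P f g R C (fun k => Ca * (k : ℝ) ^ (-a)) (fun k => Cb * (k : ℝ) ^ (-b))
      μ ζ x₁ z₁ y₀ β₀ x z y :=
    ⟨hdata, hgrad, hζ, halg, fun k hk => by
      have hk0 : (0 : ℝ) < k := by exact_mod_cast hk
      positivity⟩
  have hLg := hsmooth.nonneg_g
  have main : MeanSqDistBigO μ x (optimalSet (objective P f g R))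
      (fun k => (k : ℝ) ^ (-a) + Lf ^ 2 * Lg * (k : ℝ) ^ (-4 * a + 4 * b)
        + Lf ^ 2 * (k : ℝ) ^ (-b)) := by
    obtain ⟨c, hc, hck⟩ := hrun.distance_rate hvar hunb hconv hsol hlam hosc hsmooth.outer hLg
      hsmooth.inner ha0 ha1 hb0 hb1 hCa hCa1 hCb
    exact ⟨c, hc, fun k hk => ⟨hrun.integrable_sq_dist hconv hsol hk, hck k hk⟩⟩
  refine ⟨main, ?_, ?_⟩
  · rintro rfl rfl
    refine main.mono (D := 1 + Lf ^ 2 * Lg + Lf ^ 2) (by positivity) fun k hk => ?_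
    have hk1 : (1 : ℝ) ≤ k := by exact_mod_cast hk
    have h1 : (k : ℝ) ^ (-1 : ℝ) ≤ (k : ℝ) ^ (-(4 / 5 : ℝ)) :=
      Real.rpow_le_rpow_of_exponent_le hk1 (by norm_num)
    rw [show (-4 * 1 + 4 * (4 / 5) : ℝ) = -(4 / 5) by norm_num]
    linarith
  · rintro hL rfl rfl
    -- For a = b = 1 the middle term is L_f² L_g k⁰ and does not decay, so it must vanish.
    have hL0 : Lf ^ 2 * Lg = 0 := by rcases hL with h | h <;> simp [h]
    refine main.mono (D := 1 + Lf ^ 2) (by positivity) fun k hk => ?_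
    rw [hL0]
    linarith
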